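/- Let $n\ge 0$ be an integer. Let $Y$ be a metric space of covering dimension at most $n$ that is an absolute neighborhood extensor in dimension $n$ (an $ANE(n)$-space): every map (= continuous map) into $Y$ from a closed subset $A$ of an at most $n$-dimensional metric space extends over an open neighborhood of $A$. Let $X$ be a topological space and let $f\colon X\to Y$ be a map. Assume that $f$ is a $UV^{n-1}$-map, i.e. that for each open cover $\mathcal U$ of $Y$ the following holds: the union of those members of $\mathcal U$ that meet $f(X)$ is $Y$, and there exists an open cover $\mathcal W$ of $Y$ such that for each $W\in\mathcal W$ there exists $U\in\mathcal U$ with $f^{-1}(W)\subset f^{-1}(U)$ for which the inclusion $f^{-1}(W)\subset f^{-1}(U)$ induces trivial maps $\pi_k(f^{-1}(W),x)\to\pi_k(f^{-1}(U),x)$ for all $0\le k<n$ and all base points $x\in f^{-1}(W)$. Then $f$ is a fine $n$-homotopy equivalence, i.e. for each open cover $\mathcal U$ of $Y$ there exists a map $g\colon Y\to X$ such that $f\circ g$ is $\mathcal U$-$n$-homotopic to $\mathrm{id}_Y$ and $g\circ f$ is $f^{-1}(\mathcal U)$-$n$-homotopic to $\mathrm{id}_X$, where $f^{-1}(\mathcal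 U)=\{f^{-1}(U)\colon U\in\mathcal U\}$. Here, for an open cover $\mathcal V$ of a space $Z'$, maps $a,b\colon Z\to Z'$ are called $\mathcal V$-$n$-homotopic if for every map $\Phi$ into $Z$ from a polyhedron (the geometric realization of a simplicial complex, with the weak topology) of dimension less than $n$, the compositions $a\circ\Phi$ and $b\circ\Phi$ are homotopic by a homotopy each of whose paths lies in some member of $\mathcal V$. -/

import Mathlib

open scoped unitInterval Topology

universe u v w

namespace FineHomotopy

/-! ### Open covers and covering dimension -/

/-- `𝒰` is a family of open subsets of `Y` whose union is `Y`. -/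
def IsOpenCovering {Y : Type u} [TopologicalSpace Y] (𝒰 : Set (Set Y)) : Prop :=
  (∀ U ∈ 𝒰, IsOpen U) ∧ ⋃₀ 𝒰 = Set.univ

/-- The star of a set `A` in a family `𝒰`: the union of the members of `𝒰` that meet `A`. -/
def starOf {Y : Type u} (A : Set Y) (𝒰 : Set (Set Y)) : Set Y :=
  ⋃₀ {U ∈ 𝒰 | (U ∩ A).Nonempty}

/-- The family `f⁻¹(𝒰)` of the preimages of the members of `𝒰`. -/
def preimageFamily {X : Type u} {Y : Type v} (f : X → Y) (𝒰 : Set (Set Y)) : Set (Set X) :=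
  (fun U => f ⁻¹' U) '' 𝒰

/-- The covering dimension of `Y` is at most `n`: every open cover has an open refinement such
that every point lies in at most `n + 1` of its members. -/
def DimLE (n : ℕ) (Y : Type u) [TopologicalSpace Y] : Prop :=
  ∀ 𝒰 : Set (Set Y), IsOpenCovering 𝒰 →
    ∃ 𝒱 : Set (Set Y), IsOpenCovering 𝒱 ∧ (∀ V ∈ 𝒱, ∃ U ∈ 𝒰, V ⊆ U) ∧
      ∀ y : Y, {V ∈ 𝒱 | y ∈ V}.encard ≤ n + 1

/-! ### Absolute neighborhood extensors in dimension `n` -/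

/-- Every map into `Y` from a closed subset `A` of an at most `n`-dimensional metric space `B`
extends over an open neighborhood `O` of `A` in `B`. -/
def IsANE (n : ℕ) (Y : Type u) [TopologicalSpace Y] : Prop :=
  ∀ (B : Type u) [MetricSpace B], DimLE n B → ∀ A : Set B, IsClosed A → ∀ φ : C(A, Y),
    ∃ O : Set B, IsOpen O ∧ ∃ hAO : A ⊆ O, ∃ φ' : C(O, Y),
      ∀ a : A, φ' (Set.inclusion hAO a) = φ a

/-! ### Homotopy groups and `UV`-maps -/

/-- The map `π_k(X, x) → π_k(Y, g x)` induced by a continuous map `g`.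
(For `k = 0` this is the induced map of sets of path components.) -/
def homotopyGroupMap (k : ℕ) {X : Type u} {Y : Type v} [TopologicalSpace X] [TopologicalSpace Y]
    (g : C(X, Y)) (x : X) :
    HomotopyGroup (Fin k) X x → HomotopyGroup (Fin k) Y (g x) :=
  Quotient.map
    (fun γ => (⟨g.comp γ.1, fun y hy => congrArg g (γ.2 y hy)⟩ : GenLoop (Fin k) Y (g x)))
    (fun _ _ h => h.map fun H => ContinuousMap.HomotopyRel.compContinuousMap H g)

/-- `g` induces trivial homomorphisms on homotopy groups of dimensions less than `n`, for every
choice of the base point: every class is sent to the class of the constant loop. -/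
def TrivialOnHomotopyBelow (n : ℕ) {X : Type u} {Y : Type v} [TopologicalSpace X]
    [TopologicalSpace Y] (g : C(X, Y)) : Prop :=
  ∀ k < n, ∀ x : X, ∀ a : HomotopyGroup (Fin k) X x,
    homotopyGroupMap k g x a = Quotient.mk _ GenLoop.const

/-- The condition `(uv)` relative to the open cover `𝒰`. -/
def UVFor (n : ℕ) {X : Type u} {Y : Type v} [TopologicalSpace X] [TopologicalSpace Y]
    (f : C(X, Y)) (𝒰 : Set (Set Y)) : Prop :=
  starOf (Set.range f) 𝒰 = Set.univ ∧
    ∃ 𝒲 : Set (Set Y), IsOpenCovering 𝒲 ∧ ∀ W ∈ 𝒲, ∃ U ∈ 𝒰, ∃ h : f ⁻¹' W ⊆ f ⁻¹' U,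
      TrivialOnHomotopyBelow n
        (⟨Set.inclusion h, continuous_inclusion h⟩ : C(f ⁻¹' W, f ⁻¹' U))

/-- `f` is a `UV^{n-1}`-map. -/
def IsUVMap (n : ℕ) {X : Type u} {Y : Type v} [TopologicalSpace X] [TopologicalSpace Y]
    (f : C(X, Y)) : Prop :=
  ∀ 𝒰 : Set (Set Y), IsOpenCovering 𝒰 → UVFor n f 𝒰

/-! ### Polyhedra -/

/-- The closed geometric simplex spanned by a finite set `s` of vertices, in barycentric
coordinates, as a subspace of `V → ℝ`. -/
def closedSimplex {V : Type w} (s : Finset V) : Set (V → ℝ) :=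
  {x | (∀ v, 0 ≤ x v) ∧ (∀ v, v ∉ s → x v = 0) ∧ ∑ v ∈ s, x v = 1}

/-- The polyhedron `|K|` of a simplicial complex `K` (not assumed finite or locally finite). -/
def Polyhedron {V : Type w} (K : PreAbstractSimplicialComplex V) : Type w :=
  {x : V → ℝ // ∃ s ∈ K.faces, x ∈ closedSimplex s}

/-- The inclusion of a closed simplex of `K` into `|K|`. -/
def Polyhedron.incl {V : Type w} (K : PreAbstractSimplicialComplex V) (s : K.faces)
    (x : closedSimplex (s : Finset V)) : Polyhedron K :=
  ⟨x, s, s.2, x.2⟩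

/-- The weak (Whitehead) topology of a polyhedron: a set is open if and only if its trace on every
closed simplex is open. -/
instance Polyhedron.instTopologicalSpace {V : Type w} (K : PreAbstractSimplicialComplex V) :
    TopologicalSpace (Polyhedron K) :=
  ⨆ s : K.faces, TopologicalSpace.coinduced (Polyhedron.incl K s) inferInstance

/-- `K` has dimension less than `n`: each of its simplexes has at most `n` vertices. -/
def ComplexDimLT {V : Type w} (K : PreAbstractSimplicialComplex V) (n : ℕ) : Prop :=
  ∀ s ∈ K.faces, s.card ≤ n

/-! ### `n`-homotopies and fine `n`-homotopy equivalences -/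

/-- `f` and `g` are homotopic by a homotopy each of whose paths lies in a member of `𝒰`. -/
def HomotopicWithin {X : Type u} {Y : Type v} [TopologicalSpace X] [TopologicalSpace Y]
    (𝒰 : Set (Set Y)) (f g : C(X, Y)) : Prop :=
  ∃ H : ContinuousMap.Homotopy f g, ∀ x : X, ∃ U ∈ 𝒰, ∀ t : I, H (t, x) ∈ U

/-- `f` and `g` are `𝒰`-`n`-homotopic: for every map `Φ` into `X` from a polyhedron of dimension
less than `n`, the maps `f ∘ Φ` and `g ∘ Φ` are homotopic by a homotopy whose paths refine `𝒰`.
The universe `w` is that of the vertices of the polyhedra. -/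
def NHomotopic (n : ℕ) {X : Type u} {Y : Type v} [TopologicalSpace X] [TopologicalSpace Y]
    (𝒰 : Set (Set Y)) (f g : C(X, Y)) : Prop :=
  ∀ (V : Type w) (K : PreAbstractSimplicialComplex V), ComplexDimLT K n →
    ∀ Φ : C(Polyhedron K, X), HomotopicWithin 𝒰 (f.comp Φ) (g.comp Φ)

/-- The condition `(fne)` relative to the open cover `𝒰`. -/
def FNEFor (n : ℕ) {X : Type u} {Y : Type v} [TopologicalSpace X] [TopologicalSpace Y]
    (f : C(X, Y)) (𝒰 : Set (Set Y)) : Prop :=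
  ∃ g : C(Y, X), NHomotopic.{v, v, w} n 𝒰 (f.comp g) (ContinuousMap.id Y) ∧
    NHomotopic.{u, u, w} n (preimageFamily f 𝒰) (g.comp f) (ContinuousMap.id X)

/-- `f` is a fine `n`-homotopy equivalence. -/
def IsFineNHomotopyEquiv (n : ℕ) {X : Type u} {Y : Type v} [TopologicalSpace X]
    [TopologicalSpace Y] (f : C(X, Y)) : Prop :=
  ∀ 𝒰 : Set (Set Y), IsOpenCovering 𝒰 → FNEFor.{u, v, w} n f 𝒰

end FineHomotopy

namespace FineHomotopy

open Set

/-! ### Integer unit boxes and skeletal induction -/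

/-! Everything rests on one local property of a map to `Y`, `HasLocalExtensions`: each open cover
has a refinement such that maps of boundaries of cubes of dimension at most `n`, lying over a member
of the refinement, extend over the cubes, lying over a member of the cover. For a `UV^{n-1}`-map
this restates triviality on homotopy groups (`TrivialOnHomotopyBelow.cubeExtension`). For the
identity of an `ANE(n)`-space it is local connectedness in dimensions below `n`: spheres shrinking
to a point without small fillings would form a map from a closed subset of (cube) × (convergent
sequence) that does not extend to a neighborhood (`IsANE.exists_cubeExtension`).

The property has two consequences. First, `exists_approximate_rightInverse`: `Y` maps to the nerve
of a fine cover of order at most `n + 1`, and the nerve is mapped to `X` skeleton by skeleton; the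
composite `g` makes `f ∘ g` as close to the identity as desired. Second,
`HasLocalExtensions.exists_polyhedron_homotopy`: two maps of a polyhedron of dimension less than `n`
whose images in `Y` are close enough are homotopic through paths that are small over `Y`. Applied to
`f` and the maps `g ∘ f ∘ Φ`, `Φ`, and to `id_Y` and the maps `f ∘ g ∘ Φ`, `Φ`, this gives the two
required homotopies.

Simplexes are cut into unit boxes by scaling the greatest barycentric coordinate to `1`, so that
nerves, polyhedra and grids in cubes share one skeletal induction,
`Cell.exists_forall_of_extension`. Infinite complexes need no global subdivision: each box is
subdivided separately, after the homotopy over its boundary has been constructed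
(`HasLocalExtensions.exists_cube_homotopy`). -/

/-- A unit box with integer corners in `V → ℝ`, extended in finitely many directions. -/
structure Cell (V : Type w) where
  /-- The least corner of the box. -/
  base : V → ℤ
  /-- The directions in which the box is extended. -/
  dirs : Finset V

namespace Cell

variable {V : Type w}

/-- The set of points of a box. -/
def carrier (c : Cell V) : Set (V → ℝ) :=
  {x | ∀ v, (c.base v : ℝ) ≤ x v ∧ x v ≤ c.base v + 1 ∧ (v ∉ c.dirs → x v = c.base v)}

/-- The combinatorial boundary of a box. -/
def bdry (c : Cell V) : Set (V → ℝ) :=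
  {x ∈ c.carrier | ∃ v ∈ c.dirs, x v = c.base v ∨ x v = c.base v + 1}

/-- The smallest box that contains a given point. -/
noncomputable def minCell (x : V → ℝ) : Cell V := by
  classical
  exact
    { base := fun v => ⌊x v⌋
      dirs := if h : {v | x v ≠ ⌊x v⌋}.Finite then h.toFinset else ∅ }

theorem mem_carrier_of_eq {c : Cell V} {x : V → ℝ} (hx : x = fun v => (c.base v : ℝ)) :
    x ∈ c.carrier := by
  intro v
  simp [hx]

theorem base_mem_carrier (c : Cell V) : (fun v => (c.base v : ℝ)) ∈ c.carrier :=
  mem_carrier_of_eq rfl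

theorem nonint_subset {c : Cell V} {x : V → ℝ} (hx : x ∈ c.carrier) :
    {v | x v ≠ ⌊x v⌋} ⊆ c.dirs := by
  intro v hv
  by_contra h
  apply hv
  rw [(hx v).2.2 h]
  simp

theorem mem_minCell_dirs {c : Cell V} {x : V → ℝ} (hx : x ∈ c.carrier) (v : V) :
    v ∈ (minCell x).dirs ↔ x v ≠ ⌊x v⌋ := by
  have h : {v | x v ≠ ⌊x v⌋}.Finite := c.dirs.finite_toSet.subset (nonint_subset hx)
  simp [minCell, h]

theorem minCell_dirs_subset {c : Cell V} {x : V → ℝ} (hx : x ∈ c.carrier) :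
    (minCell x).dirs ⊆ c.dirs := fun v hv =>
  nonint_subset hx ((mem_minCell_dirs hx v).1 hv)

theorem mem_minCell {c : Cell V} {x : V → ℝ} (hx : x ∈ c.carrier) :
    x ∈ (minCell x).carrier := by
  intro v
  refine ⟨Int.floor_le _, (Int.lt_floor_add_one _).le, fun h => ?_⟩
  rw [mem_minCell_dirs hx] at h
  exact not_not.1 h

/-- A nonintegral coordinate of `x` lies strictly inside its unit interval in `c`, so its floor is
the base of `c` there; an integral coordinate is frozen. Since `minCell x` does not refer to `c`,
boxes through a common point automatically share a face. -/
theorem minCell_subset {c : Cell V} {x : V → ℝ} (hx : x ∈ c.carrier) :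
    (minCell x).carrier ⊆ c.carrier := by
  intro z hz v
  obtain ⟨h1, h2, h3⟩ := hz v
  obtain ⟨k1, k2, k3⟩ := hx v
  rw [mem_minCell_dirs hx] at h3
  change (⌊x v⌋ : ℝ) ≤ z v at h1
  change z v ≤ (⌊x v⌋ : ℝ) + 1 at h2
  change _ → z v = ⌊x v⌋ at h3
  by_cases hv : x v = ⌊x v⌋
  · have : z v = x v := by rw [h3 (not_not.2 hv), ← hv]
    rw [this]
    exact hx v
  · have hf : c.base v ≤ ⌊x v⌋ := Int.le_floor.2 k1
    have hf' : ⌊x v⌋ < c.base v + 1 := by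
      rw [Int.floor_lt]
      push_cast
      refine lt_of_le_of_ne k2 fun h => hv ?_
      rw [h]
      have : ((c.base v : ℝ) + 1) = ((c.base v + 1 : ℤ) : ℝ) := by push_cast; rfl
      rw [this, Int.floor_intCast]
    have he : ⌊x v⌋ = c.base v := by omega
    rw [he] at h1 h2
    refine ⟨h1, h2, fun hd => ?_⟩
    exact absurd (nonint_subset hx hv) hd

theorem minCell_card_lt {c : Cell V} {x : V → ℝ} (hx : x ∈ c.bdry) :
    (minCell x).dirs.card < c.dirs.card := by
  obtain ⟨hx, v, hv, h⟩ := hx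
  refine Finset.card_lt_card ⟨minCell_dirs_subset hx, fun hs => ?_⟩
  have := (mem_minCell_dirs hx v).1 (hs hv)
  apply this
  rcases h with h | h <;> rw [h]
  · simp
  · have : ((c.base v : ℝ) + 1) = ((c.base v + 1 : ℤ) : ℝ) := by push_cast; rfl
    rw [this, Int.floor_intCast]

theorem minCell_eq {c : Cell V} {x : V → ℝ} (hx : x ∈ c.carrier) (hx' : x ∉ c.bdry) :
    minCell x = c := by
  have key : ∀ v ∈ c.dirs, (c.base v : ℝ) < x v ∧ x v < c.base v + 1 := by
    intro v hv
    obtain ⟨h1, h2, -⟩ := hx v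
    refine ⟨lt_of_le_of_ne h1 fun h => hx' ⟨hx, v, hv, Or.inl h.symm⟩,
      lt_of_le_of_ne h2 fun h => hx' ⟨hx, v, hv, Or.inr h⟩⟩
  have hb : ∀ v, ⌊x v⌋ = c.base v := by
    intro v
    by_cases hv : v ∈ c.dirs
    · rw [Int.floor_eq_iff]
      exact ⟨(key v hv).1.le, (key v hv).2⟩
    · rw [(hx v).2.2 hv, Int.floor_intCast]
  have hd : (minCell x).dirs = c.dirs := by
    refine Finset.Subset.antisymm (minCell_dirs_subset hx) fun v hv => ?_
    rw [mem_minCell_dirs hx, hb]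
    exact (key v hv).1.ne'
  have hb' : (minCell x).base = c.base := funext hb
  cases c
  simp_all [minCell]

/-- **Skeletal induction.** A local property of functions on boxes that can always be extended
from the proper faces of a box to the box holds simultaneously on all boxes of a family for a
suitable function. -/
theorem exists_forall_of_extension {Z : Type*} [Nonempty Z] (𝒞 : Set (Cell V)) (n : ℕ)
    (hdim : ∀ c ∈ 𝒞, c.dirs.card < n)
    (hface : ∀ c ∈ 𝒞, ∀ c' : Cell V, c'.carrier ⊆ c.carrier → c' ∈ 𝒞)
    (P : Cell V → ((V → ℝ) → Z) → Prop)
    (hloc : ∀ c ∈ 𝒞, ∀ h h', EqOn h h' c.carrier → P c h → P c h')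
    (hext : ∀ c ∈ 𝒞, ∀ h, (∀ c' : Cell V, c'.carrier ⊆ c.carrier →
      c'.dirs.card < c.dirs.card → P c' h) → ∃ h', EqOn h h' c.bdry ∧ P c h') :
    ∃ h, ∀ c ∈ 𝒞, P c h := by
  classical
  suffices H : ∀ k, ∃ h, ∀ c ∈ 𝒞, c.dirs.card < k → P c h by
    obtain ⟨h, hh⟩ := H n
    exact ⟨h, fun c hc => hh c hc (hdim c hc)⟩
  intro k
  induction k with
  | zero => exact ⟨Classical.arbitrary _, fun c _ h => absurd h (Nat.not_lt_zero _)⟩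
  | succ k ih =>
    obtain ⟨h, hh⟩ := ih
    have hE : ∀ c : Cell V, ∃ h' : (V → ℝ) → Z, c ∈ 𝒞 → c.dirs.card = k →
        EqOn h h' c.bdry ∧ P c h' := by
      intro c
      by_cases hc : c ∈ 𝒞 ∧ c.dirs.card = k
      · obtain ⟨h', h1⟩ := hext c hc.1 h fun c' hc' hk =>
          hh c' (hface c hc.1 c' hc') (hc.2 ▸ hk)
        exact ⟨h', fun _ _ => h1⟩
      · exact ⟨h, fun h1 h2 => absurd ⟨h1, h2⟩ hc⟩
    choose E hE using hE
    -- A point of a box is in the relative interior of exactly one box, `minCell x`, so the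
    -- extensions chosen separately on all `k`-dimensional boxes can be installed at once. Points of
    -- lower boxes keep their values.
    refine ⟨fun x => if minCell x ∈ 𝒞 ∧ (minCell x).dirs.card = k then E (minCell x) x else h x,
      fun c hc hk => ?_⟩
    rcases Nat.lt_succ_iff_lt_or_eq.1 hk with hk | hk
    · refine hloc c hc h _ (fun x hx => ?_) (hh c hc hk)
      have := Finset.card_le_card (minCell_dirs_subset hx)
      rw [if_neg]
      rintro ⟨-, h2⟩
      omega
    · obtain ⟨h1, h2⟩ := hE c hc hk
      refine hloc c hc (E c) _ (fun x hx => ?_) h2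
      by_cases hb : x ∈ c.bdry
      · have := minCell_card_lt hb
        rw [if_neg, h1 hb]
        rintro ⟨-, h3⟩
        omega
      · rw [minCell_eq hx hb, if_pos ⟨hc, hk⟩]

theorem isClosed_carrier (c : Cell V) : IsClosed c.carrier := by
  have : c.carrier = ⋂ v, ({x : V → ℝ | (c.base v : ℝ) ≤ x v} ∩
      {x : V → ℝ | x v ≤ (c.base v : ℝ) + 1} ∩ {x : V → ℝ | v ∉ c.dirs → x v = (c.base v : ℝ)}) := by
    ext x
    simp [carrier, and_assoc]
  rw [this]
  refine isClosed_iInter fun v => ((isClosed_le continuous_const (continuous_apply v)).inter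
    (isClosed_le (continuous_apply v) continuous_const)).inter ?_
  by_cases hv : v ∈ c.dirs
  · simp [hv]
  · simpa [hv] using isClosed_eq (continuous_apply v) continuous_const

/-- The facet of a box obtained by fixing the coordinate `v` at its least (`ε = 0`) or greatest
(`ε = 1`) value. -/
noncomputable def facet (c : Cell V) (v : V) (ε : Fin 2) : Cell V := by
  classical
  exact { base := fun z => if z = v then c.base v + (ε : ℕ) else c.base z
          dirs := c.dirs.erase v }

theorem mem_facet {c : Cell V} {v : V} (hv : v ∈ c.dirs) {ε : Fin 2} {x : V → ℝ} :
    x ∈ (c.facet v ε).carrier ↔ x ∈ c.carrier ∧ x v = c.base v + (ε : ℕ) := by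
  constructor
  · intro h
    have hxv : x v = c.base v + (ε : ℕ) := by
      simpa [facet] using (h v).2.2 (by simp [facet])
    refine ⟨fun z => ?_, hxv⟩
    by_cases hz : z = v
    · subst hz
      rw [hxv]
      have : ((ε : ℕ) : ℝ) ≤ 1 := by exact_mod_cast Nat.lt_succ_iff.1 ε.2
      refine ⟨by simp, by linarith, fun h => absurd hv h⟩
    · have := h z
      simpa [facet, hz] using this
  · rintro ⟨h, hxv⟩ z
    by_cases hz : z = v
    · subst hz
      simp [facet, hxv]
    · simpa [facet, hz] using h z

theorem facet_subset {c : Cell V} {v : V} (hv : v ∈ c.dirs) (ε : Fin 2) :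
    (c.facet v ε).carrier ⊆ c.carrier := fun _ hx => ((mem_facet hv).1 hx).1

theorem facet_card {c : Cell V} {v : V} (hv : v ∈ c.dirs) (ε : Fin 2) :
    (c.facet v ε).dirs.card < c.dirs.card := by
  classical
  exact Finset.card_erase_lt_of_mem hv

theorem bdry_eq (c : Cell V) :
    c.bdry = ⋃ p : c.dirs × Fin 2, (c.facet p.1 p.2).carrier := by
  ext x
  simp only [mem_iUnion]
  constructor
  · rintro ⟨hx, v, hv, h | h⟩
    · exact ⟨(⟨v, hv⟩, 0), (mem_facet hv).2 ⟨hx, by simpa using h⟩⟩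
    · exact ⟨(⟨v, hv⟩, 1), (mem_facet hv).2 ⟨hx, by simpa using h⟩⟩
  · rintro ⟨⟨⟨v, hv⟩, ε⟩, h⟩
    obtain ⟨h1, h2⟩ := (mem_facet hv).1 h
    refine ⟨h1, v, hv, ?_⟩
    change x v = c.base v + (ε : ℕ) at h2
    fin_cases ε
    · left; simpa using h2
    · right; simpa using h2

theorem continuousOn_bdry {Z : Type*} [TopologicalSpace Z] {c : Cell V} {h : (V → ℝ) → Z}
    (H : ∀ c' : Cell V, c'.carrier ⊆ c.carrier → c'.dirs.card < c.dirs.card →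
      ContinuousOn h c'.carrier) : ContinuousOn h c.bdry := by
  rw [bdry_eq]
  exact (locallyFinite_of_finite _).continuousOn_iUnion (fun _ => isClosed_carrier _)
    fun p => H _ (facet_subset p.1.2 _) (facet_card p.1.2 _)

theorem exists_face_of_mem_bdry {c : Cell V} {x : V → ℝ} (hx : x ∈ c.bdry) :
    ∃ c' : Cell V, x ∈ c'.carrier ∧ c'.carrier ⊆ c.carrier ∧ c'.dirs.card < c.dirs.card :=
  ⟨minCell x, mem_minCell hx.1, minCell_subset hx.1, minCell_card_lt hx⟩

/-- The parametrization of a box by a standard cube. -/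
noncomputable def param (c : Cell V) (t : Fin c.dirs.card → I) : V → ℝ := by
  classical
  exact fun v => if h : v ∈ c.dirs then c.base v + (t (c.dirs.equivFin ⟨v, h⟩) : ℝ) else c.base v

/-- The coordinates on a box, extended to all points by clamping. -/
noncomputable def coord (c : Cell V) (x : V → ℝ) : Fin c.dirs.card → I :=
  fun i => projIcc 0 1 zero_le_one (x (c.dirs.equivFin.symm i) - c.base (c.dirs.equivFin.symm i))

theorem continuous_param (c : Cell V) : Continuous c.param := by
  refine continuous_pi fun v => ?_
  by_cases h : v ∈ c.dirs
  · simp only [param, h, dite_true]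
    fun_prop
  · simp only [param, h, dite_false]
    fun_prop

theorem continuous_coord (c : Cell V) : Continuous c.coord := by
  refine continuous_pi fun i => ?_
  exact continuous_projIcc.comp (by fun_prop)

theorem param_mem (c : Cell V) (t : Fin c.dirs.card → I) : c.param t ∈ c.carrier := by
  intro v
  by_cases h : v ∈ c.dirs
  · have := (t (c.dirs.equivFin ⟨v, h⟩)).2
    simp only [param, h, dite_true, not_true, false_imp_iff, and_true]
    exact ⟨by linarith [this.1], by linarith [this.2]⟩
  · simp [param, h]

theorem coord_coe {c : Cell V} {x : V → ℝ} (hx : x ∈ c.carrier) {v : V} (hv : v ∈ c.dirs) :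
    (c.coord x (c.dirs.equivFin ⟨v, hv⟩) : ℝ) = x v - c.base v := by
  have : x v - c.base v ∈ Icc (0 : ℝ) 1 := by
    obtain ⟨h1, h2, -⟩ := hx v
    constructor <;> linarith
  simp only [coord, Equiv.symm_apply_apply]
  rw [projIcc_of_mem zero_le_one this]

theorem param_coord {c : Cell V} {x : V → ℝ} (hx : x ∈ c.carrier) : c.param (c.coord x) = x := by
  funext v
  by_cases h : v ∈ c.dirs
  · simp [param, h, coord_coe hx h]
  · simp [param, h, (hx v).2.2 h]

theorem coord_mem_boundary {c : Cell V} {x : V → ℝ} (hx : x ∈ c.bdry) :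
    c.coord x ∈ Cube.boundary (Fin c.dirs.card) := by
  obtain ⟨hx, v, hv, h⟩ := hx
  refine ⟨c.dirs.equivFin ⟨v, hv⟩, h.imp (fun h => ?_) fun h => ?_⟩ <;>
  · apply Subtype.ext
    rw [coord_coe hx hv, h]
    simp

theorem param_mem_bdry {c : Cell V} {t : Fin c.dirs.card → I}
    (ht : t ∈ Cube.boundary (Fin c.dirs.card)) : c.param t ∈ c.bdry := by
  obtain ⟨i, hi⟩ := ht
  refine ⟨c.param_mem t, c.dirs.equivFin.symm i, (c.dirs.equivFin.symm i).2, ?_⟩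
  rcases hi with h | h <;> simp [param, h]

end Cell

/-! ### Extension of maps from the boundary of a cube -/

/-- Every map of the boundary of the `m`-cube into `S` extends to a map of the `m`-cube
into `S'`. -/
def CubeExtension (m : ℕ) {X : Type u} [TopologicalSpace X] (S S' : Set X) : Prop :=
  ∀ φ : (Fin m → I) → X, ContinuousOn φ (Cube.boundary (Fin m)) →
    (∀ t ∈ Cube.boundary (Fin m), φ t ∈ S) →
    ∃ φ' : (Fin m → I) → X, Continuous φ' ∧ EqOn φ φ' (Cube.boundary (Fin m)) ∧ ∀ t, φ' t ∈ S'

theorem CubeExtension.mono {m : ℕ} {X : Type u} [TopologicalSpace X] {S S' T T' : Set X}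
    (h : CubeExtension m S S') (hS : T ⊆ S) (hS' : S' ⊆ T') : CubeExtension m T T' := by
  intro φ hφ hT
  obtain ⟨φ', h1, h2, h3⟩ := h φ hφ fun t ht => hS (hT t ht)
  exact ⟨φ', h1, h2, fun t => hS' (h3 t)⟩

theorem isClosed_cubeBoundary (m : ℕ) : IsClosed (Cube.boundary (Fin m)) := by
  have : Cube.boundary (Fin m) = ⋃ i : Fin m, ({t : Fin m → I | t i = 0} ∪ {t | t i = 1}) := by
    ext t
    simp [Cube.boundary]
  rw [this]
  exact isClosed_iUnion_of_finite fun i =>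
    (isClosed_eq (continuous_apply i) continuous_const).union
      (isClosed_eq (continuous_apply i) continuous_const)

/-- The extension property of the `(m + 1)`-cube, in terms of families of paths that are
parametrized by the `m`-cube. -/
theorem CubeExtension.exists_paths {m : ℕ} {X : Type u} [TopologicalSpace X] {S S' : Set X}
    (h : CubeExtension (m + 1) S S') {α β : (Fin m → I) → X} (hα : Continuous α)
    (hβ : Continuous β) (hαS : ∀ t, α t ∈ S) (hβS : ∀ t, β t ∈ S) {γ : (Fin m → I) → C(I, X)}
    (hγ : ContinuousOn γ (Cube.boundary (Fin m)))
    (hγ0 : ∀ t ∈ Cube.boundary (Fin m), γ t 0 = α t)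
    (hγ1 : ∀ t ∈ Cube.boundary (Fin m), γ t 1 = β t)
    (hγS : ∀ t ∈ Cube.boundary (Fin m), ∀ r, γ t r ∈ S) :
    ∃ γ' : (Fin m → I) → C(I, X), Continuous γ' ∧ EqOn γ γ' (Cube.boundary (Fin m)) ∧
      (∀ t, γ' t 0 = α t) ∧ (∀ t, γ' t 1 = β t) ∧ ∀ t r, γ' t r ∈ S' := by
  classical
  -- Coordinate `0` is the path parameter: `α` and `β` fill the two ends of the `(m + 1)`-cube and
  -- `γ` its sides, together the whole boundary.
  let φ : (Fin (m + 1) → I) → X := fun t =>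
    if t 0 = 0 then α (Fin.tail t) else if t 0 = 1 then β (Fin.tail t) else γ (Fin.tail t) (t 0)
  have htail : Continuous (fun t : Fin (m + 1) → I => (Fin.tail t : Fin m → I)) :=
    continuous_pi fun i => continuous_apply _
  have φ0 : ∀ t : Fin (m + 1) → I, t 0 = 0 → φ t = α (Fin.tail t) := fun t ht => by simp [φ, ht]
  have φ1 : ∀ t : Fin (m + 1) → I, t 0 = 1 → φ t = β (Fin.tail t) := fun t ht => by simp [φ, ht]
  have φb : ∀ t : Fin (m + 1) → I, Fin.tail t ∈ Cube.boundary (Fin m) →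
      φ t = γ (Fin.tail t) (t 0) := by
    intro t ht
    by_cases h0 : t 0 = 0
    · rw [φ0 t h0, h0, hγ0 _ ht]
    by_cases h1 : t 0 = 1
    · rw [φ1 t h1, h1, hγ1 _ ht]
    · simp [φ, h0, h1]
  have hb : Cube.boundary (Fin (m + 1)) = ({t : Fin (m + 1) → I | t 0 = 0} ∪ {t | t 0 = 1}) ∪
      {t : Fin (m + 1) → I | (Fin.tail t : Fin m → I) ∈ Cube.boundary (Fin m)} := by
    ext t
    simp [Cube.boundary, Fin.exists_fin_succ, Fin.tail]
  have c0 : IsClosed {t : Fin (m + 1) → I | t 0 = 0} :=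
    isClosed_eq (continuous_apply 0) continuous_const
  have c1 : IsClosed {t : Fin (m + 1) → I | t 0 = 1} :=
    isClosed_eq (continuous_apply 0) continuous_const
  have cb : IsClosed {t : Fin (m + 1) → I | (Fin.tail t : Fin m → I) ∈ Cube.boundary (Fin m)} :=
    (isClosed_cubeBoundary m).preimage htail
  have hφ : ContinuousOn φ (Cube.boundary (Fin (m + 1))) := by
    rw [hb]
    refine ContinuousOn.union_of_isClosed (ContinuousOn.union_of_isClosed ?_ ?_ c0 c1) ?_
      (c0.union c1) cb
    · exact (hα.comp htail).continuousOn.congr fun t ht => φ0 t ht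
    · exact (hβ.comp htail).continuousOn.congr fun t ht => φ1 t ht
    · have h1 : ContinuousOn (fun t : Fin (m + 1) → I => γ (Fin.tail t))
          {t : Fin (m + 1) → I | (Fin.tail t : Fin m → I) ∈ Cube.boundary (Fin m)} :=
        hγ.comp htail.continuousOn fun t ht => ht
      have h2 : ContinuousOn (fun t : Fin (m + 1) → I => γ (Fin.tail t) (t 0))
          {t : Fin (m + 1) → I | (Fin.tail t : Fin m → I) ∈ Cube.boundary (Fin m)} :=
        continuous_eval.comp_continuousOn (h1.prodMk (continuous_apply 0).continuousOn)
      exact h2.congr fun t ht => φb t ht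
  obtain ⟨φ', h1, h2, h3⟩ := h φ hφ (by
    intro t ht
    rw [hb] at ht
    rcases ht with (ht | ht) | ht
    · rw [φ0 t ht]; exact hαS _
    · rw [φ1 t ht]; exact hβS _
    · rw [φb t ht]; exact hγS _ ht _)
  have hc : Continuous (fun p : (Fin m → I) × I => (Fin.cons p.2 p.1 : Fin (m + 1) → I)) := by
    refine continuous_pi fun i => ?_
    refine Fin.cases ?_ (fun i => ?_) i
    · simpa using continuous_snd
    · simp only [Fin.cons_succ]
      fun_prop
  let G : C((Fin m → I) × I, X) := ⟨fun p => φ' (Fin.cons p.2 p.1), h1.comp hc⟩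
  have e : ∀ t r, G.curry t r = φ' (Fin.cons r t) := fun t r => rfl
  refine ⟨fun t => G.curry t, G.curry.continuous, fun t ht => ?_, fun t => ?_, fun t => ?_,
    fun t r => h3 _⟩
  · ext r
    rw [e, ← h2, φb]
    · simp
    · simpa using ht
    · rw [hb]; right; simpa using ht
  · rw [e, ← h2, φ0]
    · simp
    · simp
    · rw [hb]; left; left; simp
  · rw [e, ← h2, φ1]
    · simp
    · simp
    · rw [hb]; left; right; simp

theorem Cell.exists_extension {V : Type w} {X : Type u} [TopologicalSpace X] {S S' : Set X}
    (c : Cell V) (hS : CubeExtension c.dirs.card S S') {h : (V → ℝ) → X}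
    (hc : ContinuousOn h c.bdry) (hb : ∀ x ∈ c.bdry, h x ∈ S) :
    ∃ h' : (V → ℝ) → X, EqOn h h' c.bdry ∧ ContinuousOn h' c.carrier ∧
      ∀ x ∈ c.carrier, h' x ∈ S' := by
  obtain ⟨φ', h1, h2, h3⟩ := hS (h ∘ c.param)
    (hc.comp c.continuous_param.continuousOn fun t ht => Cell.param_mem_bdry ht)
    fun t ht => hb _ (Cell.param_mem_bdry ht)
  refine ⟨φ' ∘ c.coord, fun x hx => ?_, (h1.comp c.continuous_coord).continuousOn,
    fun x _ => h3 _⟩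
  rw [Function.comp_apply, ← h2 (Cell.coord_mem_boundary hx), Function.comp_apply,
    Cell.param_coord hx.1]

theorem Cell.exists_paths {V : Type w} {X : Type u} [TopologicalSpace X] {S S' : Set X}
    (c : Cell V) (hS : CubeExtension (c.dirs.card + 1) S S') {α β : (V → ℝ) → X}
    (hα : ContinuousOn α c.carrier) (hβ : ContinuousOn β c.carrier)
    (hαS : ∀ x ∈ c.carrier, α x ∈ S) (hβS : ∀ x ∈ c.carrier, β x ∈ S)
    {γ : (V → ℝ) → C(I, X)} (hγ : ContinuousOn γ c.bdry)
    (hγ0 : ∀ x ∈ c.bdry, γ x 0 = α x) (hγ1 : ∀ x ∈ c.bdry, γ x 1 = β x)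
    (hγS : ∀ x ∈ c.bdry, ∀ r, γ x r ∈ S) :
    ∃ γ' : (V → ℝ) → C(I, X), EqOn γ γ' c.bdry ∧ ContinuousOn γ' c.carrier ∧
      (∀ x ∈ c.carrier, γ' x 0 = α x) ∧ (∀ x ∈ c.carrier, γ' x 1 = β x) ∧
      ∀ x ∈ c.carrier, ∀ r, γ' x r ∈ S' := by
  obtain ⟨γ', h1, h2, h3, h4, h5⟩ := hS.exists_paths
    (hα.comp_continuous c.continuous_param c.param_mem)
    (hβ.comp_continuous c.continuous_param c.param_mem)
    (fun t => hαS _ (c.param_mem t)) (fun t => hβS _ (c.param_mem t)) (γ := γ ∘ c.param)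
    (hγ.comp c.continuous_param.continuousOn fun t ht => Cell.param_mem_bdry ht)
    (fun t ht => hγ0 _ (Cell.param_mem_bdry ht)) (fun t ht => hγ1 _ (Cell.param_mem_bdry ht))
    (fun t ht => hγS _ (Cell.param_mem_bdry ht))
  refine ⟨γ' ∘ c.coord, fun x hx => ?_, (h1.comp c.continuous_coord).continuousOn,
    fun x hx => ?_, fun x hx => ?_, fun x _ r => h5 _ r⟩
  · rw [Function.comp_apply, ← h2 (Cell.coord_mem_boundary hx), Function.comp_apply,
      Cell.param_coord hx.1]
  · simp only [Function.comp_apply, h3, Cell.param_coord hx]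
  · simp only [Function.comp_apply, h4, Cell.param_coord hx]

/-! ### Star refinements and chains of extension properties -/

theorem starOf_mono {Y : Type u} {A B : Set Y} (h : A ⊆ B) (𝒰 : Set (Set Y)) :
    starOf A 𝒰 ⊆ starOf B 𝒰 :=
  sUnion_subset_sUnion fun _ hU => ⟨hU.1, hU.2.mono (inter_subset_inter_right _ h)⟩

theorem subset_starOf {Y : Type u} {A U : Set Y} {𝒰 : Set (Set Y)} (hU : U ∈ 𝒰)
    (h : (U ∩ A).Nonempty) : U ⊆ starOf A 𝒰 :=
  subset_sUnion_of_mem ⟨hU, h⟩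

/-- The supremum `ε y` of the radii, truncated at `1`, of balls about `y` that fit into a member of
`𝒰` is positive and `1`-Lipschitz. Hence balls of radius a small fixed fraction of `ε` have
comparable sizes whenever they meet. -/
theorem exists_star_refinement {Y : Type u} [MetricSpace Y] {𝒰 : Set (Set Y)}
    (h𝒰 : IsOpenCovering 𝒰) :
    ∃ 𝒱 : Set (Set Y), IsOpenCovering 𝒱 ∧ ∀ V ∈ 𝒱, ∃ U ∈ 𝒰, starOf V 𝒱 ⊆ U := by
  let R : Y → Set ℝ := fun y => {r | r ≤ 1 ∧ ∃ U ∈ 𝒰, Metric.ball y r ⊆ U}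
  let ε : Y → ℝ := fun y => sSup (R y)
  have hbdd : ∀ y, BddAbove (R y) := fun y => ⟨1, fun r hr => hr.1⟩
  have hpos : ∀ y, 0 < ε y := by
    intro y
    have hy : y ∈ ⋃₀ 𝒰 := h𝒰.2 ▸ mem_univ y
    obtain ⟨U, hU, hyU⟩ := hy
    obtain ⟨r, hr, hrU⟩ := Metric.isOpen_iff.1 (h𝒰.1 U hU) y hyU
    refine lt_of_lt_of_le (lt_min one_pos hr) (le_csSup (hbdd y) ⟨min_le_left _ _, U, hU, ?_⟩)
    exact (Metric.ball_subset_ball (min_le_right _ _)).trans hrU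
  have hlt : ∀ y r, r < ε y → ∃ U ∈ 𝒰, Metric.ball y r ⊆ U := by
    intro y r hr
    have hne : (R y).Nonempty := by
      by_contra h
      rw [not_nonempty_iff_eq_empty] at h
      have := hpos y
      simp [ε, h] at this
    obtain ⟨r', ⟨-, U, hU, h⟩, hrr⟩ := exists_lt_of_lt_csSup hne hr
    exact ⟨U, hU, (Metric.ball_subset_ball hrr.le).trans h⟩
  have hlip : ∀ y z, ε z ≤ ε y + dist y z := by
    intro y z
    by_contra! h
    obtain ⟨U, hU, hz⟩ := hlt z (max ((ε z + (ε y + dist y z)) / 2) 0)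
      (max_lt (by linarith) (hpos z))
    have h1 : (ε z + (ε y + dist y z)) / 2 - dist y z ∈ R y := by
      refine ⟨?_, U, hU, (Metric.ball_subset_ball' ?_).trans hz⟩
      · have : ε z ≤ 1 := by
          refine csSup_le ?_ fun r hr => hr.1
          by_contra h
          rw [not_nonempty_iff_eq_empty] at h
          have := hpos z
          simp [ε, h] at this
        have := dist_nonneg (x := y) (y := z)
        linarith
      · linarith [le_max_left ((ε z + (ε y + dist y z)) / 2) 0]
    have := le_csSup (hbdd y) h1
    change _ ≤ ε y at this
    linarith
  -- With the factor `1/8`, meeting balls satisfy `ε z ≤ (9/7) ε y`, so the star stays within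
  -- `(25/56) ε y < ε y / 2` of `y`.
  refine ⟨range fun y => Metric.ball y (ε y / 8), ⟨?_, ?_⟩, ?_⟩
  · rintro _ ⟨y, rfl⟩
    exact Metric.isOpen_ball
  · refine eq_univ_of_forall fun y => ⟨_, ⟨y, rfl⟩, Metric.mem_ball_self (by linarith [hpos y])⟩
  · rintro _ ⟨y, rfl⟩
    obtain ⟨U, hU, hyU⟩ := hlt y (ε y / 2) (by linarith [hpos y])
    refine ⟨U, hU, ?_⟩
    rintro a ⟨_, ⟨⟨z, rfl⟩, ⟨b, hb1, hb2⟩⟩, ha⟩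
    apply hyU
    rw [Metric.mem_ball] at *
    have h1 := hlip y z
    have h2 := dist_triangle a b y
    have h3 := dist_triangle a z b
    have h4 := dist_triangle_left y z b
    rw [dist_comm z b] at h3
    linarith [hpos y]

/-- Every open cover `𝒰` has a refinement `𝒲` such that maps of boundaries of cubes of dimension
at most `n` into the preimage of a member of `𝒲` extend to maps of the cubes into the preimage of
a member of `𝒰`. -/
def HasLocalExtensions (n : ℕ) {X : Type u} {Y : Type v} [TopologicalSpace X] [TopologicalSpace Y]
    (f : X → Y) : Prop :=
  ∀ 𝒰 : Set (Set Y), IsOpenCovering 𝒰 → ∃ 𝒲 : Set (Set Y), IsOpenCovering 𝒲 ∧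
    ∀ W ∈ 𝒲, ∃ U ∈ 𝒰, f ⁻¹' W ⊆ f ⁻¹' U ∧ ∀ k < n, CubeExtension (k + 1) (f ⁻¹' W) (f ⁻¹' U)

theorem IsOpenCovering.inter {Y : Type u} [TopologicalSpace Y] {𝒰 𝒱 : Set (Set Y)}
    (h𝒰 : IsOpenCovering 𝒰) (h𝒱 : IsOpenCovering 𝒱) :
    IsOpenCovering (image2 (· ∩ ·) 𝒰 𝒱) := by
  constructor
  · rintro _ ⟨U, hU, V, hV, rfl⟩
    exact (h𝒰.1 U hU).inter (h𝒱.1 V hV)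
  · refine eq_univ_of_forall fun y => ?_
    obtain ⟨U, hU, hyU⟩ : y ∈ ⋃₀ 𝒰 := h𝒰.2 ▸ mem_univ y
    obtain ⟨V, hV, hyV⟩ : y ∈ ⋃₀ 𝒱 := h𝒱.2 ▸ mem_univ y
    exact ⟨_, ⟨U, hU, V, hV, rfl⟩, hyU, hyV⟩

/-- Iterated refinement yields growing stages `S 0 D, …, S N D` in `X`, one for each dimension of a
skeletal induction. Monotonicity in `D` is what makes them usable: a face carries a smaller set `D`
than its box, and the values on the face must lie in the stages of the box. -/
theorem HasLocalExtensions.exists_chain {n : ℕ} {X : Type u} {Y : Type v} [TopologicalSpace X]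
    [MetricSpace Y] {f : X → Y} (hf : HasLocalExtensions n f) (N : ℕ) (hN : N ≤ n)
    {𝒰 : Set (Set Y)} (h𝒰 : IsOpenCovering 𝒰) :
    ∃ (𝒱 : Set (Set Y)) (S : ℕ → Set Y → Set X), IsOpenCovering 𝒱 ∧
      (∀ i D D', D ⊆ D' → S i D ⊆ S i D') ∧ (∀ D, f ⁻¹' D ⊆ S 0 D) ∧
      ∀ V ∈ 𝒱, ∀ D ⊆ V, (f ⁻¹' D).Nonempty →
        (∀ i < N, S i D ⊆ S (i + 1) D ∧ CubeExtension (i + 1) (S i D) (S (i + 1) D)) ∧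
        ∃ U ∈ 𝒰, D ⊆ U ∧ S N D ⊆ f ⁻¹' U := by
  induction N generalizing 𝒰 with
  | zero =>
    exact ⟨𝒰, fun _ D => f ⁻¹' D, h𝒰, fun _ _ _ h => preimage_mono h, fun _ => subset_rfl,
      fun V hV D hD _ => ⟨fun i hi => absurd hi (Nat.not_lt_zero _), V, hV, hD, preimage_mono hD⟩⟩
  | succ N ih =>
    obtain ⟨𝒰', h𝒰', hst⟩ := exists_star_refinement h𝒰
    obtain ⟨𝒲, h𝒲, hext⟩ := hf 𝒰' h𝒰'
    -- The factor from `𝒲` provides the next extension; the factor from `𝒰'` keeps `D` in a set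
    -- whose star fits into a member of `𝒰`.
    obtain ⟨𝒱, S, h𝒱, hmono, hbase, hS⟩ := ih (by omega) (h𝒲.inter h𝒰')
    -- A star replaces the chosen member of `𝒰'`, because a choice need not be monotone in `D`.
    refine ⟨𝒱, fun i D => if i ≤ N then S i D else f ⁻¹' (starOf (D ∩ range f) 𝒰'), h𝒱, ?_, ?_, ?_⟩
    · intro i D D' h
      by_cases hi : i ≤ N
      · simpa [hi] using hmono i D D' h
      · simpa [hi] using preimage_mono (starOf_mono (inter_subset_inter_left _ h) _)
    · intro D
      simpa using hbase D
    · intro V hV D hD hne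
      obtain ⟨h1, _, ⟨W, hW, U', hU', rfl⟩, hDU, hSN⟩ := hS V hV D hD hne
      obtain ⟨U'', hU'', hWU, hE⟩ := hext W hW
      have hsub : f ⁻¹' U'' ⊆ f ⁻¹' (starOf (D ∩ range f) 𝒰') := by
        apply preimage_mono
        -- Only the preimages of `W` and `U''` are known to be nested, so a point of `X` over `D`
        -- must witness that `U''` meets `D`.
        obtain ⟨x, hx⟩ := hne
        exact subset_starOf hU'' ⟨f x, hWU (hDU hx).1, hx, x, rfl⟩
      have hSW : S N D ⊆ f ⁻¹' W := hSN.trans (preimage_mono inter_subset_left)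
      refine ⟨fun i hi => ?_, ?_⟩
      · rcases Nat.lt_succ_iff_lt_or_eq.1 hi with hi | rfl
        · have h2 : i + 1 ≤ N := hi
          simpa [hi.le, h2] using h1 i hi
        · simp only [le_refl, if_true, show ¬ (i + 1 ≤ i) by omega, if_false]
          exact ⟨(hSW.trans hWU).trans hsub, (hE i (by omega)).mono hSW hsub⟩
      · obtain ⟨U, hU, hUst⟩ := hst U' hU'
        have hDU' : D ⊆ U' := hDU.trans inter_subset_right
        obtain ⟨x, hx⟩ := hne
        refine ⟨U, hU, (hDU'.trans (subset_starOf hU' ⟨f x, hDU' hx, hDU' hx⟩)).trans hUst, ?_⟩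
        simp only [show ¬ (N + 1 ≤ N) by omega, if_false]
        exact preimage_mono ((starOf_mono (inter_subset_left.trans hDU') _).trans hUst)

/-! ### Controlled homotopies over a cube -/

/-- The map of the standard cube, scaled by `N`, onto the standard cube. -/
noncomputable def unscale {j : ℕ} (N : ℕ) (x : Fin j → ℝ) : Fin j → I :=
  fun i => projIcc 0 1 zero_le_one (x i / N)

theorem continuous_unscale {j : ℕ} (N : ℕ) : Continuous (unscale (j := j) N) :=
  continuous_pi fun i => continuous_projIcc.comp (by fun_prop)

theorem unscale_coe {j N : ℕ} (hN : 0 < N) {x : Fin j → ℝ} {i : Fin j} (h : x i ∈ Icc (0 : ℝ) N) :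
    (unscale N x i : ℝ) = x i / N := by
  have hN' : (0 : ℝ) < N := by exact_mod_cast hN
  have : x i / N ∈ Icc (0 : ℝ) 1 := ⟨div_nonneg h.1 hN'.le, (div_le_one hN').2 h.2⟩
  rw [unscale, projIcc_of_mem zero_le_one this]

theorem unscale_scale {j N : ℕ} (hN : 0 < N) (t : Fin j → I) :
    unscale N (fun i => N * (t i : ℝ)) = t := by
  have hN' : (N : ℝ) ≠ 0 := by exact_mod_cast hN.ne'
  funext i
  simp [unscale, hN']

/-- The boxes of the grid in the standard cube scaled by `N`. -/
def gridCells (j N : ℕ) : Set (Cell (Fin j)) :=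
  {c | ∀ x ∈ c.carrier, ∀ i, x i ∈ Icc (0 : ℝ) N}

theorem exists_gridCell {j N : ℕ} (hN : 0 < N) {x : Fin j → ℝ} (hx : ∀ i, x i ∈ Icc (0 : ℝ) N) :
    ∃ k : Fin j → Fin N, x ∈ (⟨fun i => (k i : ℕ), Finset.univ⟩ : Cell (Fin j)).carrier := by
  have : ∀ i, ∃ k : Fin N, ((k : ℕ) : ℝ) ≤ x i ∧ x i ≤ (k : ℕ) + 1 := by
    intro i
    obtain ⟨h0, h1⟩ := hx i
    rcases h1.lt_or_eq with h1 | h1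
    · refine ⟨⟨⌊x i⌋₊, (Nat.floor_lt h0).2 h1⟩, Nat.floor_le h0, (Nat.lt_floor_add_one _).le⟩
    · refine ⟨⟨N - 1, by omega⟩, ?_, ?_⟩
      · rw [h1]; exact_mod_cast Nat.sub_le N 1
      · rw [h1]
        have : N ≤ N - 1 + 1 := by omega
        exact_mod_cast this
  choose k hk using this
  exact ⟨k, fun i => ⟨by simpa using (hk i).1, by simpa using (hk i).2, fun h => by simp at h⟩⟩

theorem gridCell_mem {j N : ℕ} (k : Fin j → Fin N) :
    (⟨fun i => (k i : ℕ), Finset.univ⟩ : Cell (Fin j)) ∈ gridCells j N := by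
  intro x hx i
  obtain ⟨h1, h2, -⟩ := hx i
  have hk : ((k i : ℕ) : ℝ) + 1 ≤ N := by exact_mod_cast (k i).2
  simp only [Int.cast_natCast] at h1 h2
  exact ⟨(Nat.cast_nonneg _).trans h1, h2.trans hk⟩

/-- If the extreme coordinate of `x` were not a direction of `c`, it would be constant on `c`, and
all of `c` would lie in the boundary of the cube. So it varies on `c`, and its value `0` or `N` is
an end of its range there. Thus a grid box not contained in the cube's boundary meets the prescribed
data only in its own boundary. -/
theorem mem_bdry_of_unscale_mem_boundary {j N : ℕ} (hN : 0 < N) {c : Cell (Fin j)}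
    (hc : c ∈ gridCells j N) (hc' : ∃ x ∈ c.carrier, unscale N x ∉ Cube.boundary (Fin j))
    {x : Fin j → ℝ} (hx : x ∈ c.carrier) (hb : unscale N x ∈ Cube.boundary (Fin j)) :
    x ∈ c.bdry := by
  classical
  obtain ⟨x₀, hx₀, hb₀⟩ := hc'
  have hN' : (0 : ℝ) < N := by exact_mod_cast hN
  obtain ⟨i, hi⟩ := hb
  have hi' : x i = 0 ∨ x i = N := by
    have e := unscale_coe hN (hc x hx i)
    rcases hi with hi | hi <;> rw [hi] at e
    · left
      have : x i / N = 0 := by simpa using e.symm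
      simpa [hN'.ne'] using this
    · right
      have : x i / N = 1 := by simpa using e.symm
      rwa [div_eq_one_iff_eq hN'.ne'] at this
  have hd : i ∈ c.dirs := by
    by_contra hd
    apply hb₀
    refine ⟨i, ?_⟩
    have : unscale N x₀ i = unscale N x i := by
      simp only [unscale, (hx₀ i).2.2 hd, (hx i).2.2 hd]
    rwa [this]
  refine ⟨hx, i, hd, ?_⟩
  rcases hi' with h | h
  · left
    have h1 := (hc _ c.base_mem_carrier i).1
    have h2 := (hx i).1
    rw [h] at h2 ⊢
    exact le_antisymm h1 h2
  · right
    have hz : Function.update (fun v => (c.base v : ℝ)) i (c.base i + 1) ∈ c.carrier := by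
      intro v
      by_cases hv : v = i
      · subst hv
        simp [hd]
      · simp [hv]
    have h1 := (hc _ hz i).2
    simp only [Function.update_self] at h1
    have h2 := (hx i).2.1
    rw [h] at h2 ⊢
    exact le_antisymm h2 h1

theorem dist_unscale_le {j N : ℕ} (hN : 0 < N) {c : Cell (Fin j)} {x z : Fin j → ℝ}
    (hx : x ∈ c.carrier) (hz : z ∈ c.carrier) : dist (unscale N x) (unscale N z) ≤ 1 / N := by
  have hN' : (0 : ℝ) < N := by exact_mod_cast hN
  rw [dist_pi_le_iff (by positivity)]
  intro i
  rw [Subtype.dist_eq, Real.dist_eq]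
  refine (abs_projIcc_sub_projIcc zero_le_one).trans ?_
  rw [← sub_div, abs_div, abs_of_pos hN']
  gcongr
  obtain ⟨h1, h2, -⟩ := hx i
  obtain ⟨h3, h4, -⟩ := hz i
  rw [abs_le]
  constructor <;> linarith

/-- Closeness of `α` and `β` is only pointwise, so the cube is first cut into a grid fine enough
that all prescribed data over one grid box lie over a single member of `𝒱`. The homotopy is then
built over the grid skeleton by skeleton, with `γ` kept on the boundary of the cube. -/
theorem HasLocalExtensions.exists_cube_homotopy {n : ℕ} {X : Type u} {Y : Type v}
    [TopologicalSpace X] [MetricSpace Y] {f : X → Y} (hf : HasLocalExtensions n f)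
    (hfc : Continuous f) {𝒰 : Set (Set Y)} (h𝒰 : IsOpenCovering 𝒰) :
    ∃ 𝒱 : Set (Set Y), IsOpenCovering 𝒱 ∧ (∀ V ∈ 𝒱, (f ⁻¹' V).Nonempty → ∃ U ∈ 𝒰, V ⊆ U) ∧
      ∀ j < n, ∀ α β : (Fin j → I) → X, Continuous α → Continuous β →
        (∀ t, ∃ V ∈ 𝒱, f (α t) ∈ V ∧ f (β t) ∈ V) →
        ∀ γ : (Fin j → I) → C(I, X), ContinuousOn γ (Cube.boundary (Fin j)) →
        (∀ t ∈ Cube.boundary (Fin j), γ t 0 = α t) → (∀ t ∈ Cube.boundary (Fin j), γ t 1 = β t) →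
        (∀ t ∈ Cube.boundary (Fin j), ∃ V ∈ 𝒱, ∀ r, f (γ t r) ∈ V) →
        ∃ γ' : (Fin j → I) → C(I, X), Continuous γ' ∧ EqOn γ γ' (Cube.boundary (Fin j)) ∧
          (∀ t, γ' t 0 = α t) ∧ (∀ t, γ' t 1 = β t) ∧ ∀ t, ∃ U ∈ 𝒰, ∀ r, f (γ' t r) ∈ U := by
  obtain ⟨𝒱, S, h𝒱, hmono, hbase, hS⟩ := hf.exists_chain n le_rfl h𝒰
  refine ⟨𝒱, h𝒱, fun V hV hne => ?_, ?_⟩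
  · obtain ⟨-, U, hU, h, -⟩ := hS V hV V subset_rfl hne
    exact ⟨U, hU, h⟩
  intro j hj α β hα hβ hαβ γ hγ hγ0 hγ1 hγV
  set bd := Cube.boundary (Fin j)
  -- At a boundary point, `V` contains the image of the whole path; openness in the compact-open
  -- topology keeps nearby boundary paths over the same `V`.
  have hO : ∀ t : Fin j → I, ∃ O : Set (Fin j → I), IsOpen O ∧ t ∈ O ∧ ∃ V ∈ 𝒱, ∀ t' ∈ O,
      f (α t') ∈ V ∧ f (β t') ∈ V ∧ (t' ∈ bd → ∀ r, f (γ t' r) ∈ V) := by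
    intro t
    by_cases ht : t ∈ bd
    · obtain ⟨V, hV, hVr⟩ := hγV t ht
      have hVo := (h𝒱.1 V hV).preimage hfc
      have hop : IsOpen {p : C(I, X) | MapsTo p univ (f ⁻¹' V)} :=
        ContinuousMap.isOpen_setOfPred_mapsTo isCompact_univ hVo
      obtain ⟨O, hO, hOe⟩ := continuousOn_iff'.1 hγ _ hop
      refine ⟨O ∩ (α ⁻¹' (f ⁻¹' V) ∩ β ⁻¹' (f ⁻¹' V)),
        hO.inter ((hVo.preimage hα).inter (hVo.preimage hβ)), ⟨?_, ?_, ?_⟩, V, hV, ?_⟩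
      · have : t ∈ O ∩ bd := hOe ▸ ⟨fun r _ => hVr r, ht⟩
        exact this.1
      · have := hVr 0
        rwa [hγ0 t ht] at this
      · have := hVr 1
        rwa [hγ1 t ht] at this
      · rintro t' ⟨h1, h2, h3⟩
        refine ⟨h2, h3, fun h4 r => ?_⟩
        have : t' ∈ γ ⁻¹' {p : C(I, X) | MapsTo p univ (f ⁻¹' V)} ∩ bd := hOe ▸ ⟨h1, h4⟩
        exact this.1 (mem_univ r)
    · obtain ⟨V, hV, h1, h2⟩ := hαβ t
      have hVo := (h𝒱.1 V hV).preimage hfc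
      refine ⟨bdᶜ ∩ (α ⁻¹' (f ⁻¹' V) ∩ β ⁻¹' (f ⁻¹' V)), (isClosed_cubeBoundary j).isOpen_compl.inter
        ((hVo.preimage hα).inter (hVo.preimage hβ)), ⟨ht, h1, h2⟩, V, hV, ?_⟩
      rintro t' ⟨k1, k2, k3⟩
      exact ⟨k2, k3, fun h => absurd h k1⟩
  choose O hOo hOt W hW hOW using hO
  obtain ⟨δ, hδ, hleb⟩ := lebesgue_number_lemma_of_metric (s := (univ : Set (Fin j → I)))
    isCompact_univ hOo fun t _ => mem_iUnion.2 ⟨t, hOt t⟩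
  obtain ⟨N, hN, hNδ⟩ : ∃ N : ℕ, 0 < N ∧ (1 : ℝ) / N < δ := by
    obtain ⟨N, hN⟩ := exists_nat_one_div_lt hδ
    exact ⟨N + 1, Nat.succ_pos _, by simpa using hN⟩
  -- The images in `Y` of all data prescribed over `c`: monotone in `c`, and inside one member of
  -- `𝒱` by the Lebesgue number.
  let D : Cell (Fin j) → Set Y := fun c => {y | ∃ x ∈ c.carrier, y = f (α (unscale N x)) ∨
    y = f (β (unscale N x)) ∨ (unscale N x ∈ bd ∧ ∃ r, y = f (γ (unscale N x) r))}
  have hDmono : ∀ c c' : Cell (Fin j), c'.carrier ⊆ c.carrier → D c' ⊆ D c := by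
    rintro c c' h y ⟨x, hx, hy⟩
    exact ⟨x, h hx, hy⟩
  have hDne : ∀ c, (f ⁻¹' (D c)).Nonempty := fun c =>
    ⟨α (unscale N fun v => (c.base v : ℝ)), _, c.base_mem_carrier, Or.inl rfl⟩
  have hDV : ∀ c, ∃ V ∈ 𝒱, D c ⊆ V := by
    intro c
    obtain ⟨t, ht⟩ := hleb (unscale N fun v => (c.base v : ℝ)) (mem_univ _)
    refine ⟨W t, hW t, ?_⟩
    rintro y ⟨x, hx, hy⟩
    have hxO : unscale N x ∈ O t := ht (by
      rw [Metric.mem_ball]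
      exact (dist_unscale_le hN hx c.base_mem_carrier).trans_lt hNδ)
    obtain ⟨h1, h2, h3⟩ := hOW t _ hxO
    rcases hy with rfl | rfl | ⟨hb, r, rfl⟩
    exacts [h1, h2, h3 hb r]
  have hSD : ∀ c, (∀ i < n, S i (D c) ⊆ S (i + 1) (D c) ∧
      CubeExtension (i + 1) (S i (D c)) (S (i + 1) (D c))) ∧
        ∃ U ∈ 𝒰, D c ⊆ U ∧ S n (D c) ⊆ f ⁻¹' U := by
    intro c
    obtain ⟨V, hV, hDV⟩ := hDV c
    exact hS V hV _ hDV (hDne c)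
  have hSle : ∀ c, ∀ i k, i ≤ k → k ≤ n → S i (D c) ⊆ S k (D c) := by
    intro c i k hik
    induction k, hik using Nat.le_induction with
    | base => exact fun _ => subset_rfl
    | succ k _ ih => exact fun hk => (ih (by omega)).trans ((hSD c).1 k (by omega)).1
  have hcard : ∀ c : Cell (Fin j), c.dirs.card ≤ j := fun c => by
    simpa using Finset.card_le_univ c.dirs
  have hαS : ∀ c, ∀ x ∈ c.carrier, α (unscale N x) ∈ S 0 (D c) := fun c x hx =>
    hbase _ ⟨x, hx, Or.inl rfl⟩
  have hβS : ∀ c, ∀ x ∈ c.carrier, β (unscale N x) ∈ S 0 (D c) := fun c x hx =>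
    hbase _ ⟨x, hx, Or.inr (Or.inl rfl)⟩
  have hγS : ∀ c, ∀ x ∈ c.carrier, unscale N x ∈ bd → ∀ r, γ (unscale N x) r ∈ S 0 (D c) :=
    fun c x hx hb r => hbase _ ⟨x, hx, Or.inr (Or.inr ⟨hb, r, rfl⟩)⟩
  have : Nonempty C(I, X) := ⟨ContinuousMap.const I (α fun _ => 0)⟩
  have hu := continuous_unscale (j := j) N
  -- Paths over a `d`-dimensional box fill a `(d + 1)`-cube, which moves from stage `d` on its
  -- boundary to stage `d + 1`; `d ≤ j < n` keeps this within the chain.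
  obtain ⟨h, hh⟩ := Cell.exists_forall_of_extension (Z := C(I, X)) (gridCells j N) (j + 1)
    (fun c _ => Nat.lt_succ_of_le (hcard c)) (fun c hc c' hc' x hx => hc x (hc' hx))
    (fun c h => ContinuousOn h c.carrier ∧ (∀ x ∈ c.carrier, h x 0 = α (unscale N x)) ∧
      (∀ x ∈ c.carrier, h x 1 = β (unscale N x)) ∧
      (∀ x ∈ c.carrier, unscale N x ∈ bd → h x = γ (unscale N x)) ∧
      ∀ x ∈ c.carrier, ∀ r, h x r ∈ S (c.dirs.card + 1) (D c))
    (by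
      rintro c - h h' he ⟨h1, h2, h3, h4, h5⟩
      refine ⟨h1.congr fun x hx => (he hx).symm, fun x hx => ?_, fun x hx => ?_, fun x hx => ?_,
        fun x hx => ?_⟩ <;> rw [← he hx]
      exacts [h2 x hx, h3 x hx, h4 x hx, h5 x hx])
    (by
      intro c hc h hP
      have hPb : ∀ x ∈ c.bdry, h x 0 = α (unscale N x) ∧ h x 1 = β (unscale N x) ∧
          (unscale N x ∈ bd → h x = γ (unscale N x)) ∧ ∀ r, h x r ∈ S c.dirs.card (D c) := by
        intro x hx
        obtain ⟨c', hx', hcc', hlt⟩ := Cell.exists_face_of_mem_bdry hx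
        obtain ⟨-, h2, h3, h4, h5⟩ := hP c' hcc' hlt
        refine ⟨h2 x hx', h3 x hx', h4 x hx', fun r => ?_⟩
        exact hSle c _ _ hlt (by linarith [hcard c]) (hmono _ _ _ (hDmono c c' hcc') (h5 x hx' r))
      by_cases hcb : ∀ x ∈ c.carrier, unscale N x ∈ bd
      · refine ⟨fun x => γ (unscale N x), fun x hx => (hPb x hx).2.2.1 (hcb x hx.1),
          hγ.comp hu.continuousOn hcb, fun x hx => hγ0 _ (hcb x hx),
          fun x hx => hγ1 _ (hcb x hx), fun _ _ _ => rfl, fun x hx r => ?_⟩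
        exact hSle c 0 _ (Nat.zero_le _) (by linarith [hcard c]) (hγS c x hx (hcb x hx) r)
      · push Not at hcb
        have hle : c.dirs.card < n := by linarith [hcard c]
        obtain ⟨h', e1, e2, e3, e4, e5⟩ := c.exists_paths ((hSD c).1 c.dirs.card hle).2
          (α := fun x => α (unscale N x)) (β := fun x => β (unscale N x))
          (hα.comp hu).continuousOn (hβ.comp hu).continuousOn
          (fun x hx => hSle c 0 _ (Nat.zero_le _) hle.le (hαS c x hx))
          (fun x hx => hSle c 0 _ (Nat.zero_le _) hle.le (hβS c x hx)) (γ := h)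
          (Cell.continuousOn_bdry fun c' h1 h2 => (hP c' h1 h2).1)
          (fun x hx => (hPb x hx).1) (fun x hx => (hPb x hx).2.1)
          (fun x hx => (hPb x hx).2.2.2)
        refine ⟨h', e1, e2, e3, e4, fun x hx hb => ?_, e5⟩
        have hxb := mem_bdry_of_unscale_mem_boundary hN hc hcb hx hb
        rw [← e1 hxb]
        exact (hPb x hxb).2.2.1 hb)
  have hscale : Continuous fun (t : Fin j → I) (i : Fin j) => N * (t i : ℝ) := by fun_prop
  have hscI : ∀ t : Fin j → I, ∀ i, N * (t i : ℝ) ∈ Icc (0 : ℝ) N := fun t i =>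
    ⟨mul_nonneg (Nat.cast_nonneg _) (t i).2.1,
      mul_le_of_le_one_right (Nat.cast_nonneg _) (t i).2.2⟩
  have hcell := fun t : Fin j → I => exists_gridCell hN (hscI t)
  refine ⟨fun t => h fun i => N * (t i : ℝ), ?_, fun t ht => ?_, fun t => ?_, fun t => ?_,
    fun t => ?_⟩
  · have hcont : ContinuousOn h (⋃ k : Fin j → Fin N,
        (⟨fun i => (k i : ℕ), Finset.univ⟩ : Cell (Fin j)).carrier) :=
      (locallyFinite_of_finite _).continuousOn_iUnion (fun _ => Cell.isClosed_carrier _)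
        fun k => (hh _ (gridCell_mem k)).1
    exact hcont.comp_continuous hscale fun t => mem_iUnion.2 (hcell t)
  · obtain ⟨k, hk⟩ := hcell t
    have := (hh _ (gridCell_mem k)).2.2.2.1 _ hk
    rw [unscale_scale hN] at this
    exact (this ht).symm
  · obtain ⟨k, hk⟩ := hcell t
    have := (hh _ (gridCell_mem k)).2.1 _ hk
    rwa [unscale_scale hN] at this
  · obtain ⟨k, hk⟩ := hcell t
    have := (hh _ (gridCell_mem k)).2.2.1 _ hk
    rwa [unscale_scale hN] at this
  · obtain ⟨k, hk⟩ := hcell t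
    obtain ⟨U, hU, -, hSU⟩ := (hSD ⟨fun i => (k i : ℕ), Finset.univ⟩).2
    refine ⟨U, hU, fun r => hSU (hSle _ _ n ?_ le_rfl
      ((hh _ (gridCell_mem k)).2.2.2.2 _ hk r))⟩
    simp
    omega

/-! ### The cubical structure of a simplicial complex -/

section Cubical

variable {V : Type w}

/-- The simplex spanned by `b`, normalized so that the greatest barycentric coordinate is `1`. -/
def maxSimplex (b : Finset V) : Set (V → ℝ) :=
  {x | (∀ v, 0 ≤ x v ∧ x v ≤ 1) ∧ (∀ v ∉ b, x v = 0) ∧ ∃ v ∈ b, x v = 1}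

/-- The boxes that are contained in a simplex of `𝒦`. -/
def cubicalCells (𝒦 : Set (Finset V)) : Set (Cell V) :=
  {c | ∃ b ∈ 𝒦, c.carrier ⊆ maxSimplex b}

theorem exists_base_eq_one {c : Cell V} {b : Finset V} (h : c.carrier ⊆ maxSimplex b) :
    c.dirs ⊆ b ∧ ∃ v ∈ b, v ∉ c.dirs ∧ c.base v = 1 := by
  classical
  -- At the center of the box, coordinates in the box's directions are half-integers, hence neither
  -- `0` nor `1`.
  let x : V → ℝ := fun v => if v ∈ c.dirs then c.base v + 1 / 2 else c.base v
  have hx : x ∈ c.carrier := by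
    intro v
    by_cases hv : v ∈ c.dirs
    · simp only [x, hv, if_true, not_true, false_imp_iff, and_true]
      constructor <;> linarith
    · simp [x, hv]
  have hne : ∀ v ∈ c.dirs, ∀ z : ℤ, x v ≠ z := by
    intro v hv z hz
    simp only [x, hv, if_true] at hz
    have h2 : (2 * c.base v + 1 : ℝ) = 2 * z := by linarith
    have h3 : 2 * c.base v + 1 = 2 * z := by exact_mod_cast h2
    omega
  obtain ⟨-, h0, v, hvb, hv⟩ := h hx
  have hvd : v ∉ c.dirs := fun hd => hne v hd 1 (by simpa using hv)
  refine ⟨fun z hz => ?_, v, hvb, hvd, ?_⟩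
  · by_contra hzb
    exact hne z hz 0 (by simpa using h0 z hzb)
  · have := (hx v).2.2 hvd
    rw [hv] at this
    exact_mod_cast this.symm

theorem card_dirs_lt {c : Cell V} {b : Finset V} (h : c.carrier ⊆ maxSimplex b) :
    c.dirs.card < b.card := by
  obtain ⟨h1, v, hv, hv', -⟩ := exists_base_eq_one h
  exact Finset.card_lt_card ⟨h1, fun h => hv' (h hv)⟩

/-- The box of those points of the simplex `b` whose coordinates in `a` are `1`. -/
noncomputable def cornerCell (a b : Finset V) : Cell V := by
  classical
  exact { base := fun v => if v ∈ a then 1 else 0, dirs := b \ a }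

theorem cornerCell_subset {a b : Finset V} (hab : a ⊆ b) (ha : a.Nonempty) :
    (cornerCell a b).carrier ⊆ maxSimplex b := by
  classical
  intro x hx
  refine ⟨fun v => ?_, fun v hv => ?_, ?_⟩
  · obtain ⟨h1, h2, h3⟩ := hx v
    by_cases hva : v ∈ a
    · simp [cornerCell, hva] at h3
      simp [h3]
    · simp [cornerCell, hva] at h1 h2
      exact ⟨h1, h2⟩
  · have hva : v ∉ a := fun h => hv (hab h)
    simpa [cornerCell, hva, hv] using (hx v).2.2
  · obtain ⟨v, hv⟩ := ha
    refine ⟨v, hab hv, ?_⟩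
    simpa [cornerCell, hv] using (hx v).2.2

theorem exists_mem_cornerCell {b : Finset V} {x : V → ℝ} (hx : x ∈ maxSimplex b) :
    ∃ a : {a : Finset V // a ∈ b.powerset ∧ a.Nonempty},
      x ∈ (cornerCell a.1 b).carrier := by
  classical
  obtain ⟨h1, h2, v, hvb, hv⟩ := hx
  refine ⟨⟨b.filter fun v => x v = 1, by simp, ⟨v, by simp [hvb, hv]⟩⟩, fun z => ?_⟩
  by_cases hzb : z ∈ b
  · by_cases hz : x z = 1
    · simp [cornerCell, hzb, hz]
    · simp [cornerCell, hzb, hz, h1 z]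
  · simp [cornerCell, hzb, h2 z hzb]

instance finite_corners (b : Finset V) :
    Finite {a : Finset V // a ∈ b.powerset ∧ a.Nonempty} :=
  (b.powerset.finite_toSet.subset fun _ h => h.1).to_subtype

theorem maxSimplex_eq_iUnion (b : Finset V) :
    maxSimplex b = ⋃ a : {a : Finset V // a ∈ b.powerset ∧ a.Nonempty},
      (cornerCell a.1 b).carrier := by
  refine Subset.antisymm (fun x hx => mem_iUnion.2 (exists_mem_cornerCell hx)) ?_
  exact iUnion_subset fun a => cornerCell_subset (Finset.mem_powerset.1 a.2.1) a.2.2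

theorem isClosed_maxSimplex (b : Finset V) : IsClosed (maxSimplex b) := by
  rw [maxSimplex_eq_iUnion]
  exact isClosed_iUnion_of_finite fun a => Cell.isClosed_carrier _

theorem cornerCell_mem {𝒦 : Set (Finset V)} {b : Finset V} (hb : b ∈ 𝒦)
    (a : {a : Finset V // a ∈ b.powerset ∧ a.Nonempty}) : cornerCell a.1 b ∈ cubicalCells 𝒦 :=
  ⟨b, hb, cornerCell_subset (Finset.mem_powerset.1 a.2.1) a.2.2⟩

theorem continuousOn_maxSimplex {Z : Type*} [TopologicalSpace Z] {𝒦 : Set (Finset V)}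
    {h : (V → ℝ) → Z} (hh : ∀ c ∈ cubicalCells 𝒦, ContinuousOn h c.carrier) {b : Finset V}
    (hb : b ∈ 𝒦) : ContinuousOn h (maxSimplex b) := by
  rw [maxSimplex_eq_iUnion]
  exact (locallyFinite_of_finite _).continuousOn_iUnion (fun a => Cell.isClosed_carrier _)
    fun a => hh _ (cornerCell_mem hb a)

theorem mem_cubicalCells_of_subset {𝒦 : Set (Finset V)} {c : Cell V} (hc : c ∈ cubicalCells 𝒦)
    {c' : Cell V} (h : c'.carrier ⊆ c.carrier) : c' ∈ cubicalCells 𝒦 := by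
  obtain ⟨b, hb, hcb⟩ := hc
  exact ⟨b, hb, h.trans hcb⟩

/-- The normalization of the sum of the coordinates to `1`. -/
noncomputable def sumNormalize (x : V → ℝ) : V → ℝ := fun v => x v / ∑ᶠ z, x z

/-- The normalization of the greatest coordinate to `1`. -/
noncomputable def maxNormalize (x : V → ℝ) : V → ℝ := fun v => x v / ⨆ z, x z

theorem finsum_eq_sum_of_mem_maxSimplex {b : Finset V} {x : V → ℝ} (hx : ∀ v ∉ b, x v = 0) :
    ∑ᶠ z, x z = ∑ z ∈ b, x z := by
  refine finsum_eq_sum_of_support_subset _ fun v hv => ?_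
  by_contra h
  exact hv (hx v h)

theorem sum_pos_of_mem_maxSimplex {b : Finset V} {x : V → ℝ} (hx : x ∈ maxSimplex b) :
    0 < ∑ z ∈ b, x z := by
  obtain ⟨h1, -, v, hv, hv1⟩ := hx
  exact Finset.sum_pos' (fun z _ => (h1 z).1) ⟨v, hv, by rw [hv1]; exact one_pos⟩

theorem sumNormalize_mem {b : Finset V} {x : V → ℝ} (hx : x ∈ maxSimplex b) :
    sumNormalize x ∈ closedSimplex b := by
  have hp := sum_pos_of_mem_maxSimplex hx
  have he := finsum_eq_sum_of_mem_maxSimplex hx.2.1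
  simp only [sumNormalize, he, closedSimplex, mem_ofPred_eq]
  refine ⟨fun v => div_nonneg (hx.1 v).1 hp.le, fun v hv => by rw [hx.2.1 v hv, zero_div], ?_⟩
  rw [← Finset.sum_div, div_self hp.ne']

theorem continuousOn_sumNormalize (b : Finset V) :
    ContinuousOn (sumNormalize (V := V)) (maxSimplex b) := by
  have h1 : ContinuousOn (fun (x : V → ℝ) (v : V) => x v / ∑ z ∈ b, x z) (maxSimplex b) := by
    refine continuousOn_pi.2 fun v => ContinuousOn.div (by fun_prop) (by fun_prop) fun x hx => ?_
    exact (sum_pos_of_mem_maxSimplex hx).ne'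
  refine h1.congr fun x hx => ?_
  funext v
  rw [sumNormalize, finsum_eq_sum_of_mem_maxSimplex hx.2.1]

theorem iSup_eq_sup' {b : Finset V} (hb : b.Nonempty) {x : V → ℝ} (hx : x ∈ closedSimplex b) :
    ⨆ z, x z = b.sup' hb x := by
  have hle : ∀ v, x v ≤ b.sup' hb x := by
    intro v
    by_cases hv : v ∈ b
    · exact Finset.le_sup' x hv
    · obtain ⟨z, hz⟩ := hb
      rw [hx.2.1 v hv]
      exact (hx.1 z).trans (Finset.le_sup' x hz)
  have : Nonempty V := ⟨hb.choose⟩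
  refine le_antisymm (ciSup_le hle) (Finset.sup'_le _ _ fun v _ => le_ciSup ⟨b.sup' hb x, ?_⟩ v)
  rintro _ ⟨v, rfl⟩
  exact hle v

theorem sup'_pos {b : Finset V} (hb : b.Nonempty) {x : V → ℝ} (hx : x ∈ closedSimplex b) :
    0 < b.sup' hb x := by
  by_contra! h
  have : ∑ v ∈ b, x v ≤ 0 := Finset.sum_nonpos fun v hv => (Finset.le_sup' x hv).trans h
  rw [hx.2.2] at this
  linarith

theorem maxNormalize_mem {b : Finset V} (hb : b.Nonempty) {x : V → ℝ} (hx : x ∈ closedSimplex b) :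
    maxNormalize x ∈ maxSimplex b := by
  have hp := sup'_pos hb hx
  simp only [maxNormalize, iSup_eq_sup' hb hx, maxSimplex, mem_ofPred_eq]
  refine ⟨fun v => ⟨div_nonneg (hx.1 v) hp.le, (div_le_one hp).2 ?_⟩,
    fun v hv => by rw [hx.2.1 v hv, zero_div], ?_⟩
  · by_cases hv : v ∈ b
    · exact Finset.le_sup' x hv
    · rw [hx.2.1 v hv]
      exact hp.le
  · obtain ⟨v, hv, he⟩ := Finset.exists_mem_eq_sup' hb x
    exact ⟨v, hv, by rw [he] at hp ⊢; exact div_self hp.ne'⟩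

theorem continuousOn_maxNormalize {b : Finset V} (hb : b.Nonempty) :
    ContinuousOn (maxNormalize (V := V)) (closedSimplex b) := by
  have h1 : ContinuousOn (fun (x : V → ℝ) (v : V) => x v / b.sup' hb x) (closedSimplex b) := by
    refine continuousOn_pi.2 fun v => ContinuousOn.div (by fun_prop) ?_ fun x hx =>
      (sup'_pos hb hx).ne'
    exact ContinuousOn.finset_sup'_apply hb fun z _ => (continuous_apply z).continuousOn
  refine h1.congr fun x hx => ?_
  funext v
  rw [maxNormalize, iSup_eq_sup' hb hx]

theorem sumNormalize_maxNormalize {b : Finset V} (hb : b.Nonempty) {x : V → ℝ}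
    (hx : x ∈ closedSimplex b) : sumNormalize (maxNormalize x) = x := by
  have hp := sup'_pos hb hx
  have hm := maxNormalize_mem hb hx
  funext v
  rw [sumNormalize, finsum_eq_sum_of_mem_maxSimplex hm.2.1]
  simp only [maxNormalize, iSup_eq_sup' hb hx]
  rw [← Finset.sum_div, hx.2.2]
  field_simp

end Cubical

/-! ### Controlled homotopies over a polyhedron -/

theorem Polyhedron.continuous_incl {V : Type w} (K : PreAbstractSimplicialComplex V)
    (s : K.faces) : Continuous (Polyhedron.incl K s) :=
  continuous_iff_coinduced_le.2 (le_iSup (fun s : K.faces =>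
    TopologicalSpace.coinduced (Polyhedron.incl K s) inferInstance) s)

theorem Polyhedron.continuous_of_incl {V : Type w} {K : PreAbstractSimplicialComplex V}
    {Z : Type*} [TopologicalSpace Z] {g : Polyhedron K → Z}
    (h : ∀ s, Continuous (g ∘ Polyhedron.incl K s)) : Continuous g :=
  continuous_iSup_dom.2 fun s => continuous_coinduced_dom.2 (h s)

/-- The skeletal induction handles functions on all of `V → ℝ`; the values off the polyhedron are
arbitrary. -/
theorem exists_extension_of_polyhedron {V : Type w} {K : PreAbstractSimplicialComplex V}
    {X : Type u} [TopologicalSpace X] [Nonempty X] (Φ : C(Polyhedron K, X)) :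
    ∃ φ : (V → ℝ) → X, (∀ p : Polyhedron K, φ p.1 = Φ p) ∧
      ∀ s ∈ K.faces, ContinuousOn φ (closedSimplex s) := by
  classical
  refine ⟨fun x => if h : ∃ s ∈ K.faces, x ∈ closedSimplex s then Φ ⟨x, h⟩
    else Classical.arbitrary X, fun p => dif_pos p.2, fun s hs => ?_⟩
  rw [continuousOn_iff_continuous_domRestrict]
  convert! Φ.continuous.comp (Polyhedron.continuous_incl K ⟨s, hs⟩) using 1
  funext x
  exact dif_pos (⟨s, hs, x.2⟩ : ∃ s ∈ K.faces, x.1 ∈ closedSimplex s)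

/-- The homotopy is constructed over the unit boxes of the complex by increasing dimension, with
`exists_cube_homotopy` for each box. Each dimension costs one passage to a coarser cover, and there
are at most `n` of them. -/
theorem HasLocalExtensions.exists_polyhedron_homotopy {n : ℕ} {X : Type u} {Y : Type v}
    [TopologicalSpace X] [MetricSpace Y] {f : C(X, Y)} (hf : HasLocalExtensions n f)
    {𝒰 : Set (Set Y)} (h𝒰 : IsOpenCovering 𝒰) :
    ∃ 𝒱 : Set (Set Y), IsOpenCovering 𝒱 ∧ ∀ (V : Type w) (K : PreAbstractSimplicialComplex V),
      ComplexDimLT K n → ∀ Φ Ψ : C(Polyhedron K, X),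
        (∀ p, ∃ V ∈ 𝒱, f (Φ p) ∈ V ∧ f (Ψ p) ∈ V) →
        HomotopicWithin (preimageFamily f 𝒰) Φ Ψ := by
  choose F hF using fun 𝒰 : {𝒰 : Set (Set Y) // IsOpenCovering 𝒰} =>
    hf.exists_cube_homotopy f.continuous 𝒰.2
  let F' : {𝒰 : Set (Set Y) // IsOpenCovering 𝒰} → {𝒰 : Set (Set Y) // IsOpenCovering 𝒰} :=
    fun 𝒰 => ⟨F 𝒰, (hF 𝒰).1⟩
  -- Paths over the boundary of a `d`-dimensional box are controlled by `W d`, and those over the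
  -- box by `W (d + 1)`; the last cover `W n` is `𝒰`.
  let W : ℕ → {𝒰 : Set (Set Y) // IsOpenCovering 𝒰} := fun i => F'^[n - i] ⟨𝒰, h𝒰⟩
  have hWn : (W n).1 = 𝒰 := by simp [W]
  have hWs : ∀ i < n, (W i).1 = F (W (i + 1)) := by
    intro i hi
    have : n - i = (n - (i + 1)) + 1 := by omega
    simp only [W, this, Function.iterate_succ_apply', F']
  have href : ∀ i k, i ≤ k → k ≤ n → ∀ V ∈ (W i).1, (f ⁻¹' V).Nonempty →
      ∃ U ∈ (W k).1, V ⊆ U := by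
    intro i k hik
    induction k, hik using Nat.le_induction with
    | base => exact fun _ V hV _ => ⟨V, hV, subset_rfl⟩
    | succ k _ ih =>
      intro hk V hV hne
      obtain ⟨U, hU, hVU⟩ := ih (by omega) V hV hne
      rw [hWs k (by omega)] at hU
      obtain ⟨U', hU', h⟩ := (hF (W (k + 1))).2.1 U hU (hne.mono (preimage_mono hVU))
      exact ⟨U', hU', hVU.trans h⟩
  refine ⟨(W 0).1, (W 0).2, fun V K hK Φ Ψ hΦΨ => ?_⟩
  rcases isEmpty_or_nonempty (Polyhedron K) with hemp | ⟨⟨p₀⟩⟩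
  · have : Φ = Ψ := by
      ext p
      exact isEmptyElim p
    subst this
    exact ⟨ContinuousMap.Homotopy.refl Φ, fun p => isEmptyElim p⟩
  have hX : Nonempty X := ⟨Φ p₀⟩
  have hIX : Nonempty C(I, X) := ⟨ContinuousMap.const I (Φ p₀)⟩
  obtain ⟨φ, hφ, hφc⟩ := exists_extension_of_polyhedron Φ
  obtain ⟨ψ, hψ, hψc⟩ := exists_extension_of_polyhedron Ψ
  let α : (V → ℝ) → X := φ ∘ sumNormalize
  let β : (V → ℝ) → X := ψ ∘ sumNormalize
  have hα : ∀ b ∈ K.faces, ContinuousOn α (maxSimplex b) := fun b hb =>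
    (hφc b hb).comp (continuousOn_sumNormalize b) fun x hx => sumNormalize_mem hx
  have hβ : ∀ b ∈ K.faces, ContinuousOn β (maxSimplex b) := fun b hb =>
    (hψc b hb).comp (continuousOn_sumNormalize b) fun x hx => sumNormalize_mem hx
  have hαβ : ∀ b ∈ K.faces, ∀ x ∈ maxSimplex b, ∃ V ∈ (W 0).1, f (α x) ∈ V ∧ f (β x) ∈ V := by
    intro b hb x hx
    let p : Polyhedron K := ⟨sumNormalize x, b, hb, sumNormalize_mem hx⟩
    have := hΦΨ p
    rwa [← hφ p, ← hψ p] at this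
  obtain ⟨h, hh⟩ := Cell.exists_forall_of_extension (Z := C(I, X)) (cubicalCells K.faces) n
    (fun c hc => by
      obtain ⟨b, hb, hcb⟩ := hc
      exact (card_dirs_lt hcb).trans_le (hK b hb))
    (fun c hc c' hcc' => mem_cubicalCells_of_subset hc hcc')
    (fun c h => ContinuousOn h c.carrier ∧ (∀ x ∈ c.carrier, h x 0 = α x) ∧
      (∀ x ∈ c.carrier, h x 1 = β x) ∧
      ∀ x ∈ c.carrier, ∃ U ∈ (W (c.dirs.card + 1)).1, ∀ r, f (h x r) ∈ U)
    (by
      rintro c - h h' he ⟨h1, h2, h3, h4⟩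
      refine ⟨h1.congr fun x hx => (he hx).symm, fun x hx => ?_, fun x hx => ?_, fun x hx => ?_⟩ <;>
        rw [← he hx]
      exacts [h2 x hx, h3 x hx, h4 x hx])
    (by
      rintro c ⟨b, hb, hcb⟩ h hP
      have hcn : c.dirs.card < n := (card_dirs_lt hcb).trans_le (hK b hb)
      have hPb : ∀ x ∈ c.bdry, h x 0 = α x ∧ h x 1 = β x ∧
          ∃ U ∈ (W c.dirs.card).1, ∀ r, f (h x r) ∈ U := by
        intro x hx
        obtain ⟨c', hx', hcc', hlt⟩ := Cell.exists_face_of_mem_bdry hx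
        obtain ⟨-, h2, h3, h4⟩ := hP c' hcc' hlt
        obtain ⟨U, hU, hr⟩ := h4 x hx'
        obtain ⟨U', hU', hUU⟩ := href _ c.dirs.card hlt hcn.le U hU ⟨h x 0, hr 0⟩
        exact ⟨h2 x hx', h3 x hx', U', hU', fun r => hUU (hr r)⟩
      obtain ⟨γ', e1, e2, e3, e4, e5⟩ := (hF (W (c.dirs.card + 1))).2.2 c.dirs.card hcn
        (α ∘ c.param) (β ∘ c.param)
        (((hα b hb).mono hcb).comp_continuous c.continuous_param c.param_mem)
        (((hβ b hb).mono hcb).comp_continuous c.continuous_param c.param_mem)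
        (fun t => by
          rw [← hWs _ hcn]
          obtain ⟨V, hV, h1, h2⟩ := hαβ b hb _ (hcb (c.param_mem t))
          obtain ⟨U, hU, hVU⟩ := href 0 _ (Nat.zero_le _) hcn.le V hV ⟨_, h1⟩
          exact ⟨U, hU, hVU h1, hVU h2⟩)
        (h ∘ c.param)
        ((Cell.continuousOn_bdry fun c' h1 h2 => (hP c' h1 h2).1).comp
          c.continuous_param.continuousOn fun t ht => Cell.param_mem_bdry ht)
        (fun t ht => (hPb _ (Cell.param_mem_bdry ht)).1)
        (fun t ht => (hPb _ (Cell.param_mem_bdry ht)).2.1)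
        (fun t ht => by
          rw [← hWs _ hcn]
          exact (hPb _ (Cell.param_mem_bdry ht)).2.2)
      refine ⟨γ' ∘ c.coord, fun x hx => ?_, (e1.comp c.continuous_coord).continuousOn,
        fun x hx => ?_, fun x hx => ?_, fun x _ => e5 _⟩
      · rw [Function.comp_apply, ← e2 (Cell.coord_mem_boundary hx), Function.comp_apply,
          Cell.param_coord hx.1]
      · simp only [Function.comp_apply, e3, Cell.param_coord hx]
      · simp only [Function.comp_apply, e4, Cell.param_coord hx])
  have hne : ∀ s ∈ K.faces, s.Nonempty := fun s hs => (K.isRelLowerSet_faces hs).1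
  -- For a path-valued map, continuity in the weak topology is checked on closed simplexes;
  -- evaluation of paths then gives the homotopy, without analyzing the topology of the product with
  -- `I`.
  let H : C(Polyhedron K, C(I, X)) := ⟨fun p => h (maxNormalize p.1), by
    refine Polyhedron.continuous_of_incl fun s => ?_
    exact ((continuousOn_maxSimplex (fun c hc => (hh c hc).1) s.2).comp
      (continuousOn_maxNormalize (hne s s.2)) fun x hx =>
        maxNormalize_mem (hne s s.2) hx).comp_continuous continuous_subtype_val fun x => x.2⟩
  have hcell : ∀ p : Polyhedron K, ∃ c ∈ cubicalCells K.faces, maxNormalize p.1 ∈ c.carrier := by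
    rintro ⟨x, s, hs, hx⟩
    obtain ⟨a, ha⟩ := exists_mem_cornerCell (maxNormalize_mem (hne s hs) hx)
    exact ⟨_, cornerCell_mem hs a, ha⟩
  have hid : ∀ p : Polyhedron K, sumNormalize (maxNormalize p.1) = p.1 := by
    rintro ⟨x, s, hs, hx⟩
    exact sumNormalize_maxNormalize (hne s hs) hx
  refine ⟨⟨⟨fun q => H q.2 q.1, ?_⟩, fun p => ?_, fun p => ?_⟩, fun p => ?_⟩
  · exact continuous_eval.comp ((H.continuous.comp continuous_snd).prodMk continuous_fst)
  · obtain ⟨c, hc, hp⟩ := hcell p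
    change h (maxNormalize p.1) 0 = Φ p
    rw [(hh c hc).2.1 _ hp, ← hφ]
    simp only [α, Function.comp_apply, hid]
  · obtain ⟨c, hc, hp⟩ := hcell p
    change h (maxNormalize p.1) 1 = Ψ p
    rw [(hh c hc).2.2.1 _ hp, ← hψ]
    simp only [β, Function.comp_apply, hid]
  · obtain ⟨c, hc, hp⟩ := hcell p
    obtain ⟨U, hU, hr⟩ := (hh c hc).2.2.2 _ hp
    obtain ⟨b, hb, hcb⟩ := hc
    obtain ⟨U', hU', hUU⟩ := href _ n ((card_dirs_lt hcb).trans_le (hK b hb)) le_rfl U hU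
      ⟨_, hr 0⟩
    rw [hWn] at hU'
    exact ⟨f ⁻¹' U', ⟨U', hU', rfl⟩, fun r => hUU (hr r)⟩

/-! ### Approximate right inverses -/

/-- A partition of unity maps `Y` to the cubical nerve of a cover of order at most `n + 1`, whose
boxes have dimension at most `n`. Density of the image supplies values at the vertices, and the
chain of local extensions supplies the higher skeleta. A box containing the image of `y` is sent
over a member of `𝒰` that also contains `y`. -/
theorem exists_approximate_rightInverse {n : ℕ} {X : Type u} {Y : Type v} [TopologicalSpace X]
    [Nonempty X] [MetricSpace Y] (hdim : DimLE n Y) {f : C(X, Y)} (hf : HasLocalExtensions n f)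
    (hfd : DenseRange f) {𝒰 : Set (Set Y)} (h𝒰 : IsOpenCovering 𝒰) :
    ∃ g : C(Y, X), ∀ y, ∃ U ∈ 𝒰, f (g y) ∈ U ∧ y ∈ U := by
  classical
  obtain ⟨𝒱, S, h𝒱, hmono, hbase, hS⟩ := hf.exists_chain n le_rfl h𝒰
  obtain ⟨𝒩, h𝒩, h𝒩𝒱, hord⟩ := hdim 𝒱 h𝒱
  obtain ⟨ρ, hρ⟩ := PartitionOfUnity.exists_isSubordinate (s := (univ : Set Y)) isClosed_univ
    (fun i : 𝒩 => (i : Set Y)) (fun i => h𝒩.1 i i.2) (by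
      rw [← sUnion_eq_iUnion, h𝒩.2])
  have hρU : ∀ i y, ρ i y ≠ 0 → y ∈ (i : Set Y) := fun i y h => hρ i (subset_tsupport _ h)
  let 𝒦 : Set (Finset 𝒩) := {b | (⋂ i ∈ b, (i : Set Y)).Nonempty}
  have hcard : ∀ b ∈ 𝒦, b.card ≤ n + 1 := by
    rintro b ⟨y, hy⟩
    have h1 : ((b.map (Function.Embedding.subtype _) : Finset (Set Y)) : Set (Set Y)).encard ≤
        n + 1 := by
      refine (encard_le_encard ?_).trans (hord y)
      intro V hV
      simp only [Finset.coe_map, Function.Embedding.subtype_apply, mem_image] at hV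
      obtain ⟨i, hi, rfl⟩ := hV
      exact ⟨i.2, by simpa using mem_iInter₂.1 hy i hi⟩
    rw [encard_coe_eq_coe_finsetCard, Finset.card_map] at h1
    exact_mod_cast h1
  -- At most `n + 1` nonzero terms sum to `1`, so some `ρ i y` is at least `1 / (n + 1)`; truncation
  -- therefore makes the greatest coordinate exactly `1`.
  let κ : Y → 𝒩 → ℝ := fun y i => min 1 ((n + 1) * ρ i y)
  have hκ : Continuous κ := continuous_pi fun i =>
    continuous_const.min (continuous_const.mul (ρ i).continuous)
  let b : Y → Finset 𝒩 := fun y => ρ.finsupport y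
  have hb : ∀ y i, i ∈ b y ↔ ρ i y ≠ 0 := fun y i => by simp [b]
  have hb𝒦 : ∀ y, b y ∈ 𝒦 := fun y =>
    ⟨y, mem_iInter₂.2 fun i hi => hρU i y ((hb y i).1 hi)⟩
  have hκb : ∀ y, κ y ∈ maxSimplex (b y) := by
    intro y
    have hsum : ∑ i ∈ b y, ρ i y = 1 := ρ.sum_finsupport (mem_univ y)
    have hn : (0 : ℝ) < n + 1 := by positivity
    refine ⟨fun i => ⟨le_min zero_le_one (mul_nonneg hn.le (ρ.nonneg i y)), min_le_left _ _⟩,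
      fun i hi => ?_, ?_⟩
    · have : ρ i y = 0 := by
        by_contra h
        exact hi ((hb y i).2 h)
      simp [κ, this]
    · by_contra! hlt
      have hlt' : ∀ i ∈ b y, ρ i y < 1 / (n + 1) := by
        intro i hi
        by_contra! h
        refine hlt i hi (min_eq_left ?_)
        rwa [div_le_iff₀' hn] at h
      have hne : (b y).Nonempty := by
        rw [Finset.nonempty_iff_ne_empty]
        intro h
        simp [h] at hsum
      have h1 := Finset.sum_lt_sum_of_nonempty hne hlt'
      rw [hsum, Finset.sum_const, nsmul_eq_mul] at h1
      have h2 : ((b y).card : ℝ) ≤ n + 1 := by exact_mod_cast hcard _ (hb𝒦 y)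
      have h3 : ((b y).card : ℝ) * (1 / (n + 1)) ≤ 1 := by
        rw [mul_one_div, div_le_one hn]
        exact h2
      linarith
  -- The coordinates with base `1` are those identically `1` on the box. Passing to a face can only
  -- add such coordinates, which shrinks `D`.
  let D : Cell 𝒩 → Set Y := fun c => {y | ∀ i : 𝒩, c.base i = 1 → y ∈ (i : Set Y)}
  have hDmono : ∀ c ∈ cubicalCells 𝒦, ∀ c' : Cell 𝒩, c'.carrier ⊆ c.carrier → D c' ⊆ D c := by
    rintro c ⟨b, hb, hcb⟩ c' hcc' y hy i hi
    apply hy i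
    have h1 := (hcc' c'.base_mem_carrier i).1
    have h2 : (c'.base i : ℝ) ≤ 1 := ((hcb (hcc' c'.base_mem_carrier)).1 i).2
    rw [hi] at h1
    have h3 : (1 : ℤ) ≤ c'.base i := by exact_mod_cast h1
    have h4 : c'.base i ≤ 1 := by exact_mod_cast h2
    exact le_antisymm h4 h3
  have hDne : ∀ c ∈ cubicalCells 𝒦, (f ⁻¹' (D c)).Nonempty := by
    rintro c ⟨b, ⟨y, hy⟩, hcb⟩
    have hD : D c = ⋂ i ∈ b.filter (fun i => c.base i = 1), (i : Set Y) := by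
      ext y
      simp only [mem_iInter₂, Finset.mem_filter]
      refine ⟨fun h i hi => h i hi.2, fun h i hi => h i ⟨?_, hi⟩⟩
      by_contra hib
      have := (hcb c.base_mem_carrier).2.1 i hib
      simp [hi] at this
    have hop : IsOpen (D c) := by
      rw [hD]
      exact isOpen_biInter_finset fun i _ => h𝒩.1 i i.2
    have hyD : y ∈ D c := by
      rw [hD]
      exact mem_iInter₂.2 fun i hi => mem_iInter₂.1 hy i (Finset.mem_filter.1 hi).1
    exact hfd.exists_mem_open hop ⟨y, hyD⟩
  have hSD : ∀ c ∈ cubicalCells 𝒦, (∀ i < n, S i (D c) ⊆ S (i + 1) (D c) ∧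
      CubeExtension (i + 1) (S i (D c)) (S (i + 1) (D c))) ∧
        ∃ U ∈ 𝒰, D c ⊆ U ∧ S n (D c) ⊆ f ⁻¹' U := by
    intro c hc
    obtain ⟨b, hb, hcb⟩ := id hc
    obtain ⟨-, i, -, -, hi⟩ := exists_base_eq_one hcb
    obtain ⟨V, hV, hiV⟩ := h𝒩𝒱 i i.2
    exact hS V hV _ (fun y hy => hiV (hy i hi)) (hDne c hc)
  have hSle : ∀ c ∈ cubicalCells 𝒦, ∀ i k, i ≤ k → k ≤ n → S i (D c) ⊆ S k (D c) := by
    intro c hc i k hik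
    induction k, hik using Nat.le_induction with
    | base => exact fun _ => subset_rfl
    | succ k _ ih => exact fun hk => (ih (by omega)).trans ((hSD c hc).1 k (by omega)).1
  have hdirs : ∀ c ∈ cubicalCells 𝒦, c.dirs.card ≤ n := by
    rintro c ⟨b, hb, hcb⟩
    have := card_dirs_lt hcb
    have := hcard b hb
    omega
  obtain ⟨h, hh⟩ := Cell.exists_forall_of_extension (Z := X) (cubicalCells 𝒦) (n + 1)
    (fun c hc => Nat.lt_succ_of_le (hdirs c hc))
    (fun c hc c' hcc' => mem_cubicalCells_of_subset hc hcc')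
    (fun c h => ContinuousOn h c.carrier ∧ ∀ x ∈ c.carrier, h x ∈ S c.dirs.card (D c))
    (by
      rintro c - h h' he ⟨h1, h2⟩
      refine ⟨h1.congr fun x hx => (he hx).symm, fun x hx => ?_⟩
      rw [← he hx]
      exact h2 x hx)
    (by
      intro c hc h hP
      rcases hk : c.dirs.card with - | k
      · obtain ⟨x₀, hx₀⟩ := hDne c hc
        refine ⟨fun _ => x₀, fun x hx => ?_, continuousOn_const, fun x _ => hbase _ hx₀⟩
        obtain ⟨-, v, hv, -⟩ := hx
        rw [Finset.card_eq_zero] at hk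
        simp [hk] at hv
      · have hkn : k < n := by have := hdirs c hc; omega
        refine c.exists_extension (S := S k (D c)) ?_
          (Cell.continuousOn_bdry fun c' h1 h2 => (hP c' h1 h2).1) fun x hx => ?_
        · rw [hk]
          exact ((hSD c hc).1 k hkn).2
        · obtain ⟨c', hx', hcc', hlt⟩ := Cell.exists_face_of_mem_bdry hx
          exact hSle c hc _ _ (by omega) hkn.le
            (hmono _ _ _ (hDmono c hc c' hcc') ((hP c' hcc' hlt).2 x hx')))
  refine ⟨⟨fun y => h (κ y), ?_⟩, fun y => ?_⟩
  · rw [continuous_iff_continuousAt]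
    intro y
    -- Near `y` only finitely many vertices occur, so `κ` lands in a finite union of closed
    -- simplexes, on which continuity of `h` can be glued in the product topology.
    obtain ⟨O, hO, hfin⟩ := ρ.locallyFinite y
    let 𝒦' : Set (Finset 𝒩) := {b | b ∈ 𝒦 ∧ b ⊆ hfin.toFinset}
    have : Finite 𝒦' := (hfin.toFinset.powerset.finite_toSet.subset fun b hb => by
      simpa using hb.2).to_subtype
    have hcont : ContinuousOn h (⋃ b : 𝒦', maxSimplex b.1) :=
      (locallyFinite_of_finite _).continuousOn_iUnion (fun b => isClosed_maxSimplex _)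
        fun b => continuousOn_maxSimplex (fun c hc => (hh c hc).1) b.2.1
    have hmaps : MapsTo κ O (⋃ b : 𝒦', maxSimplex b.1) := by
      intro z hz
      refine mem_iUnion.2 ⟨⟨b z, hb𝒦 z, fun i hi => ?_⟩, hκb z⟩
      rw [Finite.mem_toFinset]
      exact ⟨z, (hb z i).1 hi, hz⟩
    exact (hcont.comp hκ.continuousOn hmaps).continuousAt hO
  · obtain ⟨a, ha⟩ := exists_mem_cornerCell (hκb y)
    have hc := cornerCell_mem (hb𝒦 y) a
    obtain ⟨U, hU, hDU, hSU⟩ := (hSD _ hc).2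
    refine ⟨U, hU, hSU (hSle _ hc _ n (hdirs _ hc) le_rfl ((hh _ hc).2 _ ha)), hDU ?_⟩
    intro i hi
    apply hρU
    intro h0
    have := (ha i).1
    rw [hi] at this
    simp [κ, h0] at this
    linarith

/-! ### From homotopy groups to extensions over cubes -/

/-- The affine map of the standard cube onto the unit ball of the supremum norm. -/
def center {m : ℕ} (t : Fin m → I) : Fin m → ℝ := fun i => 2 * (t i : ℝ) - 1

/-- The inverse of `center`, extended by clamping. -/
noncomputable def uncenter {m : ℕ} (x : Fin m → ℝ) : Fin m → I :=
  fun i => projIcc 0 1 zero_le_one ((x i + 1) / 2)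

theorem continuous_center {m : ℕ} : Continuous (center (m := m)) := by
  unfold center
  fun_prop

theorem continuous_uncenter {m : ℕ} : Continuous (uncenter (m := m)) :=
  continuous_pi fun i => continuous_projIcc.comp (by fun_prop)

theorem uncenter_center {m : ℕ} (t : Fin m → I) : uncenter (center t) = t := by
  funext i
  simp [uncenter, center]

theorem center_uncenter {m : ℕ} {x : Fin m → ℝ} (hx : ‖x‖ ≤ 1) : center (uncenter x) = x := by
  funext i
  have h := (norm_le_pi_norm x i).trans hx
  rw [Real.norm_eq_abs, abs_le] at h
  have : (x i + 1) / 2 ∈ Icc (0 : ℝ) 1 := ⟨by linarith, by linarith⟩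
  simp only [center, uncenter]
  rw [projIcc_of_mem zero_le_one this]
  simp only
  ring

theorem norm_center_le {m : ℕ} (t : Fin m → I) : ‖center t‖ ≤ 1 := by
  rw [pi_norm_le_iff_of_nonneg zero_le_one]
  intro i
  rw [Real.norm_eq_abs, abs_le]
  have := (t i).2
  constructor <;> simp only [center] <;> linarith [this.1, this.2]

theorem norm_center_eq_one_iff {m : ℕ} {t : Fin m → I} :
    ‖center t‖ = 1 ↔ t ∈ Cube.boundary (Fin m) := by
  constructor
  · intro h
    by_contra hb
    refine absurd h (ne_of_lt ?_)
    rw [pi_norm_lt_iff one_pos]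
    intro i
    have h0 : t i ≠ 0 := fun h => hb ⟨i, Or.inl h⟩
    have h1 : t i ≠ 1 := fun h => hb ⟨i, Or.inr h⟩
    have h0' : (0 : ℝ) < t i := unitInterval.pos_iff_ne_zero.2 h0
    have h1' : (t i : ℝ) < 1 := unitInterval.lt_one_iff_ne_one.2 h1
    rw [Real.norm_eq_abs, abs_lt]
    constructor <;> simp only [center] <;> linarith
  · rintro ⟨i, hi⟩
    refine le_antisymm (norm_center_le t) ?_
    refine le_trans ?_ (norm_le_pi_norm (center t) i)
    rcases hi with hi | hi <;> simp [center, hi]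
    norm_num

/-- A map of the unit ball that, after normalization, wraps the ball around the unit sphere of
the next dimension. -/
noncomputable def wrap {k : ℕ} (x : Fin k → ℝ) : Fin (k + 1) → ℝ :=
  Fin.cons (1 - 2 * ‖x‖) ((1 - ‖x‖) • x)

theorem wrap_zero {k : ℕ} (x : Fin k → ℝ) : wrap x 0 = 1 - 2 * ‖x‖ := rfl

theorem wrap_succ {k : ℕ} (x : Fin k → ℝ) (i : Fin k) : wrap x i.succ = (1 - ‖x‖) * x i := rfl

theorem tail_wrap {k : ℕ} (x : Fin k → ℝ) :
    (fun i : Fin k => wrap x i.succ) = (1 - ‖x‖) • x := rfl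

theorem continuous_wrap {k : ℕ} : Continuous (wrap (k := k)) := by
  refine continuous_pi fun i => ?_
  refine Fin.cases ?_ (fun i => ?_) i
  · simp only [wrap_zero]
    fun_prop
  · simp only [wrap_succ]
    fun_prop

theorem wrap_ne_zero {k : ℕ} (x : Fin k → ℝ) : wrap x ≠ 0 := by
  intro h
  have h0 : 1 - 2 * ‖x‖ = 0 := congrFun h 0
  have h1 : (1 - ‖x‖) • x = 0 := by
    rw [← tail_wrap, h]
    rfl
  have h2 : ‖x‖ = 1 / 2 := by linarith
  rw [h2, smul_eq_zero] at h1
  rcases h1 with h1 | h1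
  · norm_num at h1
  · simp [h1] at h2

/-- The ratio of the first coordinate to the norm of the tail determines `‖x‖`; once the norms agree
and differ from `1`, the tail determines `x`. -/
theorem eq_or_of_wrap_eq_smul {k : ℕ} {x z : Fin k → ℝ} (hx : ‖x‖ ≤ 1) (hz : ‖z‖ ≤ 1) {a : ℝ}
    (ha : 0 < a) (h : wrap x = a • wrap z) : x = z ∨ (‖x‖ = 1 ∧ ‖z‖ = 1) := by
  have h0 : 1 - 2 * ‖x‖ = a * (1 - 2 * ‖z‖) := congrFun h 0
  have h1 : (1 - ‖x‖) • x = a • (1 - ‖z‖) • z := by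
    rw [← tail_wrap, ← tail_wrap, h]
    rfl
  have h2 : (1 - ‖x‖) * ‖x‖ = a * ((1 - ‖z‖) * ‖z‖) := by
    have := congrArg norm h1
    rwa [norm_smul, norm_smul, norm_smul, Real.norm_of_nonneg (by linarith),
      Real.norm_of_nonneg ha.le, Real.norm_of_nonneg (by linarith)] at this
  set r := ‖x‖ with hr
  set s := ‖z‖ with hs
  have hr0 : 0 ≤ r := norm_nonneg x
  have hs0 : 0 ≤ s := norm_nonneg z
  -- Elimination of `a` from `h0` and `h2`. The last factor vanishes only for `{r, s} = {0, 1}`,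
  -- where `1 - 2r` and `1 - 2s` have opposite signs, against `a > 0`.
  have key : a * ((s - r) * ((1 - r) * (1 - s) + r * s)) = 0 := by
    linear_combination (1 - s) * s * a * h0 - (1 - 2 * s) * a * h2
  have hrs : r = s := by
    by_contra hne
    have h3 : (1 - r) * (1 - s) + r * s = 0 := by
      simpa [ha.ne', sub_eq_zero, Ne.symm hne] using key
    have h4 : (1 - r) * (1 - s) = 0 := by nlinarith [mul_nonneg hr0 hs0]
    have h5 : r * s = 0 := by nlinarith
    rcases mul_eq_zero.1 h5 with h5 | h5
    · rw [h5] at h4 h0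
      have : s = 1 := by linarith
      rw [this] at h0
      linarith
    · rw [h5] at h4 h0
      have : r = 1 := by linarith
      rw [this] at h0
      linarith
  by_cases hr1 : r = 1
  · exact Or.inr ⟨hr1, hrs ▸ hr1⟩
  left
  have ha1 : a = 1 := by
    rw [← hrs] at h0 h2
    by_cases hh : 1 - 2 * r = 0
    · have : r = 1 / 2 := by linarith
      rw [this] at h2
      linarith
    · have : (a - 1) * (1 - 2 * r) = 0 := by linarith
      rcases mul_eq_zero.1 this with h | h
      · linarith
      · exact absurd h hh
  rw [ha1, one_smul, ← hrs] at h1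
  exact smul_right_injective _ (sub_ne_zero.2 (Ne.symm hr1)) h1

/-- Away from the poles, the tail of `e` fixes the direction of `x`, and the intermediate value
theorem finds its norm. For `k = 0` the ball is a point, which cannot reach both poles. -/
theorem exists_wrap_eq_smul {k : ℕ} (hk : 0 < k) {e : Fin (k + 1) → ℝ} (he : ‖e‖ = 1) :
    ∃ x : Fin k → ℝ, ‖x‖ ≤ 1 ∧ ∃ a : ℝ, 0 < a ∧ wrap x = a • e := by
  have : Nonempty (Fin k) := ⟨⟨0, hk⟩⟩
  set z : Fin k → ℝ := fun i => e i.succ with hz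
  by_cases hz0 : z = 0
  · have hs : |e 0| = 1 := by
      refine le_antisymm (he ▸ norm_le_pi_norm e 0) ?_
      rw [← he, pi_norm_le_iff_of_nonneg (abs_nonneg _)]
      intro i
      refine Fin.cases le_rfl (fun i => ?_) i
      have : e i.succ = 0 := congrFun hz0 i
      simp [this]
    rcases eq_or_eq_neg_of_abs_eq hs with hs | hs
    · refine ⟨0, by simp, 1, one_pos, ?_⟩
      funext i
      refine Fin.cases ?_ (fun i => ?_) i
      · simp [wrap_zero, hs]
      · have : e i.succ = 0 := congrFun hz0 i
        simp [wrap_succ, this]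
    · have hn : ‖(fun _ => 1 : Fin k → ℝ)‖ = 1 := by
        rw [pi_norm_const]
        simp
      refine ⟨fun _ => 1, hn.le, 1, one_pos, ?_⟩
      funext i
      refine Fin.cases ?_ (fun i => ?_) i
      · simp [wrap_zero, hs, hn]
        norm_num
      · have : e i.succ = 0 := congrFun hz0 i
        simp [wrap_succ, this, hn]
  · have hζ : 0 < ‖z‖ := norm_pos_iff.2 hz0
    have hcont : ContinuousOn (fun r : ℝ => (1 - 2 * r) * ‖z‖ - e 0 * ((1 - r) * r)) (Icc 0 1) := by
      fun_prop
    obtain ⟨r, ⟨hr0, hr1⟩, hr⟩ := intermediate_value_Icc' (zero_le_one (α := ℝ)) hcont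
      (show (0 : ℝ) ∈ _ from ⟨by norm_num, by norm_num⟩)
    have hr : (1 - 2 * r) * ‖z‖ - e 0 * ((1 - r) * r) = 0 := hr
    have hr0' : r ≠ 0 := by
      rintro rfl
      norm_num at hr
      exact hz0 hr
    have hr1' : r ≠ 1 := by
      rintro rfl
      norm_num at hr
      exact hz0 hr
    have hp : 0 < r := lt_of_le_of_ne hr0 (Ne.symm hr0')
    have hp1 : 0 < 1 - r := sub_pos.2 (lt_of_le_of_ne hr1 hr1')
    have hn : ‖(r / ‖z‖) • z‖ = r := by
      rw [norm_smul, Real.norm_of_nonneg (by positivity), div_mul_cancel₀ _ hζ.ne']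
    refine ⟨(r / ‖z‖) • z, hn.le.trans hr1, (1 - r) * r / ‖z‖, by positivity, ?_⟩
    funext i
    refine Fin.cases ?_ (fun i => ?_) i
    · rw [wrap_zero, hn, Pi.smul_apply, smul_eq_mul]
      field_simp
      linarith
    · rw [wrap_succ, hn, Pi.smul_apply, Pi.smul_apply, smul_eq_mul, smul_eq_mul]
      field_simp
      rfl

/-- The map of the cube onto the unit sphere of the next dimension that collapses the boundary of
the cube to a point. -/
noncomputable def wrapSphere {k : ℕ} (t : Fin k → I) : Fin (k + 1) → ℝ :=
  ‖wrap (center t)‖⁻¹ • wrap (center t)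

theorem continuous_wrapSphere {k : ℕ} : Continuous (wrapSphere (k := k)) := by
  have h := (continuous_wrap (k := k)).comp continuous_center
  exact (h.norm.inv₀ fun t => norm_ne_zero_iff.2 (wrap_ne_zero _)).smul h

theorem norm_wrapSphere {k : ℕ} (t : Fin k → I) : ‖wrapSphere t‖ = 1 := by
  rw [wrapSphere, norm_smul, norm_inv, norm_norm]
  exact inv_mul_cancel₀ (norm_ne_zero_iff.2 (wrap_ne_zero _))

theorem wrapSphere_eq {k : ℕ} {t t' : Fin k → I} (h : wrapSphere t = wrapSphere t') :
    t = t' ∨ (t ∈ Cube.boundary (Fin k) ∧ t' ∈ Cube.boundary (Fin k)) := by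
  have h1 : 0 < ‖wrap (center t)‖ := norm_pos_iff.2 (wrap_ne_zero _)
  have h2 : 0 < ‖wrap (center t')‖ := norm_pos_iff.2 (wrap_ne_zero _)
  have h3 : wrap (center t) = (‖wrap (center t)‖ * ‖wrap (center t')‖⁻¹) • wrap (center t') := by
    rw [mul_smul]
    change _ = _ • wrapSphere t'
    rw [← h, wrapSphere, smul_smul, mul_inv_cancel₀ h1.ne', one_smul]
  rcases eq_or_of_wrap_eq_smul (norm_center_le t) (norm_center_le t') (by positivity) h3 with h | h
  · left
    rw [← uncenter_center t, h, uncenter_center]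
  · exact Or.inr ⟨norm_center_eq_one_iff.1 h.1, norm_center_eq_one_iff.1 h.2⟩

theorem wrapSphere_of_mem_boundary {k : ℕ} {t : Fin k → I} (h : t ∈ Cube.boundary (Fin k)) :
    wrapSphere t = Fin.cons (-1) 0 := by
  have h1 := norm_center_eq_one_iff.2 h
  have h2 : wrap (center t) = Fin.cons (-1) 0 := by
    rw [wrap, h1]
    norm_num
  have h3 := norm_wrapSphere t
  have h4 : ‖(Fin.cons (-1) 0 : Fin (k + 1) → ℝ)‖ = 1 := by
    refine le_antisymm ?_ ?_
    · rw [pi_norm_le_iff_of_nonneg zero_le_one]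
      intro i
      refine Fin.cases (by simp) (fun i => by simp) i
    · simpa using norm_le_pi_norm (Fin.cons (-1) 0 : Fin (k + 1) → ℝ) 0
  rw [wrapSphere, h2, h4, inv_one, one_smul]

theorem exists_wrapSphere_eq {k : ℕ} (hk : 0 < k) {e : Fin (k + 1) → ℝ} (he : ‖e‖ = 1) :
    ∃ t : Fin k → I, wrapSphere t = e := by
  obtain ⟨x, hx, a, ha, h⟩ := exists_wrap_eq_smul hk he
  refine ⟨uncenter x, ?_⟩
  rw [wrapSphere, center_uncenter hx, h, norm_smul, he, Real.norm_of_nonneg ha.le, mul_one,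
    smul_smul, inv_mul_cancel₀ ha.ne', one_smul]

/-- The map of the product of an interval and a cube onto the cube of the next dimension that
wraps the cubes `{r} × I^k` around concentric spheres. -/
noncomputable def wrapCube {k : ℕ} (p : I × (Fin k → I)) : Fin (k + 1) → I :=
  uncenter ((1 - (p.1 : ℝ)) • wrapSphere p.2)

theorem continuous_wrapCube {k : ℕ} : Continuous (wrapCube (k := k)) :=
  continuous_uncenter.comp
    ((by fun_prop : Continuous fun p : I × (Fin k → I) => (1 - (p.1 : ℝ))).smul
      (continuous_wrapSphere.comp continuous_snd))

theorem norm_smul_wrapSphere {k : ℕ} (p : I × (Fin k → I)) :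
    ‖(1 - (p.1 : ℝ)) • wrapSphere p.2‖ = 1 - p.1 := by
  rw [norm_smul, norm_wrapSphere, mul_one, Real.norm_of_nonneg (sub_nonneg.2 p.1.2.2)]

theorem surjective_wrapCube {k : ℕ} (hk : 0 < k) : Function.Surjective (wrapCube (k := k)) := by
  intro t
  by_cases h0 : center t = 0
  · refine ⟨(1, 0), ?_⟩
    rw [wrapCube]
    simp only [Icc.coe_one, sub_self, zero_smul]
    rw [← h0, uncenter_center]
  · have hn : 0 < ‖center t‖ := norm_pos_iff.2 h0
    obtain ⟨s, hs⟩ := exists_wrapSphere_eq hk (e := ‖center t‖⁻¹ • center t) (by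
      rw [norm_smul, norm_inv, norm_norm, inv_mul_cancel₀ hn.ne'])
    refine ⟨(⟨1 - ‖center t‖, by linarith [norm_center_le t], by linarith⟩, s), ?_⟩
    rw [wrapCube]
    simp only [hs, sub_sub_cancel, smul_smul, mul_inv_cancel₀ hn.ne', one_smul, uncenter_center]

theorem wrapCube_eq {k : ℕ} {p p' : I × (Fin k → I)} (h : wrapCube p = wrapCube p') :
    p.1 = p'.1 ∧ (p.1 = 1 ∨ p.2 = p'.2 ∨
      (p.2 ∈ Cube.boundary (Fin k) ∧ p'.2 ∈ Cube.boundary (Fin k))) := by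
  have hle : ∀ p : I × (Fin k → I), ‖(1 - (p.1 : ℝ)) • wrapSphere p.2‖ ≤ 1 := fun p => by
    rw [norm_smul_wrapSphere]
    linarith [p.1.2.1]
  have h1 : (1 - (p.1 : ℝ)) • wrapSphere p.2 = (1 - (p'.1 : ℝ)) • wrapSphere p'.2 := by
    rw [← center_uncenter (hle p), ← center_uncenter (hle p')]
    exact congrArg center h
  have h2 : p.1 = p'.1 := by
    have := congrArg norm h1
    rw [norm_smul_wrapSphere, norm_smul_wrapSphere] at this
    exact Subtype.ext (by linarith)
  refine ⟨h2, ?_⟩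
  by_cases h3 : p.1 = 1
  · exact Or.inl h3
  right
  rw [← h2] at h1
  have h4 : (1 - (p.1 : ℝ)) ≠ 0 := fun h => h3 (Subtype.ext (by rw [Icc.coe_one]; linarith))
  exact wrapSphere_eq (smul_right_injective _ h4 h1)

theorem uncenter_mem_boundary {m : ℕ} {e : Fin m → ℝ} (he : ‖e‖ = 1) :
    uncenter e ∈ Cube.boundary (Fin m) := by
  rw [← norm_center_eq_one_iff, center_uncenter he.le, he]

/-- If the inclusion of `S` into `S'` is trivial on homotopy groups of dimensions less than `n`,
then maps of boundaries of cubes of dimension at most `n` into `S` extend to maps of the cubes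
into `S'`. -/
theorem TrivialOnHomotopyBelow.cubeExtension {n : ℕ} {X : Type u} [TopologicalSpace X]
    {S S' : Set X} (hSS' : S ⊆ S')
    (h : TrivialOnHomotopyBelow n (⟨inclusion hSS', continuous_inclusion hSS'⟩ : C(S, S')))
    {k : ℕ} (hk : k < n) : CubeExtension (k + 1) S S' := by
  intro φ hφ hφS
  have null : ∀ (x : S) (γ : GenLoop (Fin k) S x), ∃ H : C(I × (Fin k → I), S'),
      (∀ t, (H (0, t) : X) = γ t) ∧ (∀ t, (H (1, t) : X) = x) ∧
      ∀ r, ∀ t ∈ Cube.boundary (Fin k), (H (r, t) : X) = x := by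
    intro x γ
    have h1 := h k hk x (Quotient.mk _ γ)
    obtain ⟨H⟩ : GenLoop.Homotopic _ _ := Quotient.exact h1
    refine ⟨H.toContinuousMap, fun t => ?_, fun t => ?_, fun r t ht => ?_⟩
    · exact congrArg Subtype.val (H.apply_zero t)
    · exact congrArg Subtype.val (H.apply_one t)
    · refine (congrArg Subtype.val (H.eq_fst r ht)).trans ?_
      exact congrArg Subtype.val (γ.2 t ht)
  rcases Nat.eq_zero_or_pos k with rfl | hk0
  -- For `k = 0` wrapping is not onto; triviality on path components directly joins the images of
  -- the two ends.
  · have hb0 : (fun _ => 0 : Fin 1 → I) ∈ Cube.boundary (Fin (0 + 1)) := ⟨0, Or.inl rfl⟩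
    have hb1 : (fun _ => 1 : Fin 1 → I) ∈ Cube.boundary (Fin (0 + 1)) := ⟨0, Or.inr rfl⟩
    obtain ⟨H, H0, H1, -⟩ := null ⟨φ fun _ => 1, hφS _ hb1⟩
      ⟨ContinuousMap.const _ ⟨φ fun _ => 0, hφS _ hb0⟩, fun t ht => by
        obtain ⟨i, -⟩ := ht
        exact i.elim0⟩
    refine ⟨fun t => H (t 0, Fin.elim0), ?_, ?_, fun t => (H _).2⟩
    · exact continuous_subtype_val.comp
        (H.continuous.comp ((continuous_apply 0).prodMk continuous_const))
    · rintro t ⟨i, hi⟩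
      have hi0 : i = 0 := Fin.fin_one_eq_zero i
      subst hi0
      have ht : t = fun _ => t 0 := by
        funext j
        rw [Fin.fin_one_eq_zero j]
      rcases hi with hi | hi
      · simp only [hi, H0]
        rw [ht, hi]
        rfl
      · simp only [hi, H1]
        rw [ht, hi]
  · let e₀ : Fin (k + 1) → ℝ := Fin.cons (-1) 0
    have hq : ∀ t : Fin k → I, uncenter (wrapSphere t) ∈ Cube.boundary (Fin (k + 1)) :=
      fun t => uncenter_mem_boundary (norm_wrapSphere t)
    have he₀ : uncenter e₀ ∈ Cube.boundary (Fin (k + 1)) := by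
      have := hq (fun _ => 0)
      rwa [wrapSphere_of_mem_boundary ⟨⟨0, hk0⟩, Or.inl rfl⟩] at this
    have hγ : Continuous fun t : Fin k → I => φ (uncenter (wrapSphere t)) :=
      hφ.comp_continuous (continuous_uncenter.comp continuous_wrapSphere) hq
    obtain ⟨H, H0, H1, Hb⟩ := null ⟨φ (uncenter e₀), hφS _ he₀⟩
      ⟨⟨fun t => ⟨φ (uncenter (wrapSphere t)), hφS _ (hq t)⟩, hγ.subtype_mk _⟩, fun t ht =>
        Subtype.ext (by
          change φ (uncenter (wrapSphere t)) = _
          rw [wrapSphere_of_mem_boundary ht])⟩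
    -- A null homotopy of the wrapped sphere descends to the cube: `wrapCube` identifies points only
    -- at the end `r = 1` or over the boundary of the `k`-cube, where `H` is constant.
    have hquot : Topology.IsQuotientMap
        (⟨wrapCube, continuous_wrapCube⟩ : C(I × (Fin k → I), Fin (k + 1) → I)) :=
      continuous_wrapCube.isClosedMap.isQuotientMap continuous_wrapCube (surjective_wrapCube hk0)
    have hfac : Function.FactorsThrough H
        (⟨wrapCube, continuous_wrapCube⟩ : C(I × (Fin k → I), Fin (k + 1) → I)) := by
      rintro ⟨r, t⟩ ⟨r', t'⟩ hp
      obtain ⟨h1, h2⟩ := wrapCube_eq hp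
      simp only at h1 h2
      subst h1
      apply Subtype.ext
      rcases h2 with rfl | rfl | ⟨h2, h3⟩
      · rw [H1, H1]
      · rfl
      · rw [Hb r t h2, Hb r t' h3]
    let L := hquot.lift H hfac
    have hL : ∀ p, L (wrapCube p) = H p := fun p =>
      DFunLike.congr_fun (hquot.lift_comp H hfac) p
    refine ⟨fun t => L t, continuous_subtype_val.comp L.continuous, fun t ht => ?_,
      fun t => (L t).2⟩
    obtain ⟨s, hs⟩ := exists_wrapSphere_eq hk0 (norm_center_eq_one_iff.2 ht)
    have hst : wrapCube (0, s) = t := by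
      rw [wrapCube]
      simp only [Icc.coe_zero, sub_zero, one_smul, hs, uncenter_center]
    simp only
    rw [← hst, hL, H0]
    change _ = φ (uncenter (wrapSphere s))
    rw [hs, uncenter_center, hst]

theorem IsUVMap.hasLocalExtensions {n : ℕ} {X : Type u} {Y : Type v} [TopologicalSpace X]
    [TopologicalSpace Y] {f : C(X, Y)} (hf : IsUVMap n f) : HasLocalExtensions n f := by
  intro 𝒰 h𝒰
  obtain ⟨-, 𝒲, h𝒲, h⟩ := hf 𝒰 h𝒰
  refine ⟨𝒲, h𝒲, fun W hW => ?_⟩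
  obtain ⟨U, hU, hs, ht⟩ := h W hW
  exact ⟨U, hU, hs, fun k hk => ht.cubeExtension hs hk⟩

theorem IsUVMap.denseRange {n : ℕ} {X : Type u} {Y : Type v} [TopologicalSpace X]
    [TopologicalSpace Y] [T1Space Y] {f : C(X, Y)} (hf : IsUVMap n f) : DenseRange f := by
  intro y
  rw [mem_closure_iff]
  intro O hO hy
  -- Only `O` covers `y` in this cover, so `O` has to meet the image.
  obtain ⟨hst, -⟩ := hf {O, {y}ᶜ} ⟨by
      rintro U (rfl | rfl)
      exacts [hO, isOpen_compl_singleton], by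
      refine eq_univ_of_forall fun z => ?_
      by_cases hz : z = y
      · exact ⟨O, Or.inl rfl, hz ▸ hy⟩
      · exact ⟨{y}ᶜ, Or.inr rfl, hz⟩⟩
  obtain ⟨U, ⟨rfl | rfl, hU⟩, hyU⟩ : y ∈ starOf (range f) {O, {y}ᶜ} := hst ▸ mem_univ y
  · exact hU
  · exact absurd rfl hyU

/-! ### The covering dimension of a cube -/

/-- The sets `A j` of indices with `d i > 1 / (2j + 4)` increase with `j`. At the first `j` with `|A
j| ≤ j`, minimality forces `|A j| = j` and, if `j > 0`, `A (j - 1) = A j`; so no `d i` lies in the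
interval from `1 / (2j + 4)` to `1 / (2j + 2)`, around the threshold `1 / (2j + 3)`. -/
theorem exists_finset_gap {m : ℕ} (d : Fin m → ℝ) :
    ∃ S : Finset (Fin m), (∀ i ∉ S, d i < 1 / (2 * S.card + 3)) ∧
      ∀ i ∈ S, 1 / (2 * S.card + 3) < d i := by
  classical
  let A : ℕ → Finset (Fin m) := fun j => Finset.univ.filter fun i => 1 / (2 * (j : ℝ) + 4) < d i
  have hex : ∃ j, (A j).card ≤ j := ⟨m, by simpa using Finset.card_le_univ (A m)⟩
  obtain ⟨j, hj, hmin⟩ : ∃ j, (A j).card ≤ j ∧ ∀ i < j, i < (A i).card :=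
    ⟨Nat.find hex, Nat.find_spec hex, fun i hi => not_le.1 (Nat.find_min hex hi)⟩
  have hlow : ∀ i ∉ A j, d i ≤ 1 / (2 * (j : ℝ) + 4) := by
    intro i hi
    simpa [A] using hi
  have hj4 : 1 / (2 * (j : ℝ) + 4) < 1 / (2 * (j : ℝ) + 3) :=
    one_div_lt_one_div_of_lt (by positivity) (by linarith)
  have hcard : (A j).card = j ∧ ∀ i ∈ A j, 1 / (2 * (j : ℝ) + 3) < d i := by
    rcases j with - | j
    · have h0 : A 0 = ∅ := by simpa using hj
      simp [h0]
    · have hsub : A j ⊆ A (j + 1) := by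
        intro i hi
        simp only [A, Finset.mem_filter, Finset.mem_univ, true_and] at hi ⊢
        refine lt_trans (one_div_lt_one_div_of_lt (by positivity) ?_) hi
        push_cast
        linarith
      have h1 := hmin j (Nat.lt_succ_self j)
      have h2 := Finset.card_le_card hsub
      have he : A j = A (j + 1) := Finset.eq_of_subset_of_card_le hsub (by omega)
      refine ⟨by omega, fun i hi => ?_⟩
      rw [← he] at hi
      simp only [A, Finset.mem_filter, Finset.mem_univ, true_and] at hi
      refine lt_trans (one_div_lt_one_div_of_lt (by positivity) ?_) hi
      push_cast
      linarith
  refine ⟨A j, fun i hi => ?_, fun i hi => ?_⟩ <;> rw [hcard.1]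
  · exact (hlow i hi).trans_lt hj4
  · exact hcard.2 i hi

/-- The points of the cube, scaled by `N`, that are close to the open face with the directions
`S` and the least corner `z` of the integer grid, and far from its boundary. -/
def facePiece {m : ℕ} (N : ℕ) (S : Finset (Fin m)) (z : Fin m → ℤ) : Set (Fin m → I) :=
  {t | (∀ i ∉ S, |N * (t i : ℝ) - z i| < 1 / (2 * S.card + 3)) ∧
    ∀ i ∈ S, z i + 1 / (2 * S.card + 3) < N * (t i : ℝ) ∧
      N * (t i : ℝ) < z i + 1 - 1 / (2 * S.card + 3)}

theorem isOpen_facePiece {m : ℕ} (N : ℕ) (S : Finset (Fin m)) (z : Fin m → ℤ) :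
    IsOpen (facePiece N S z) := by
  have : facePiece N S z = (⋂ i, {t : Fin m → I | i ∉ S →
      |N * (t i : ℝ) - z i| < 1 / (2 * S.card + 3)}) ∩ ⋂ i, {t : Fin m → I | i ∈ S →
        z i + 1 / (2 * (S.card : ℝ) + 3) < N * (t i : ℝ) ∧
          N * (t i : ℝ) < z i + 1 - 1 / (2 * (S.card : ℝ) + 3)} := by
    ext t
    simp [facePiece]
  rw [this]
  refine (isOpen_iInter_of_finite fun i => ?_).inter (isOpen_iInter_of_finite fun i => ?_)
  · by_cases hi : i ∈ S
    · simp [hi]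
    · simp only [hi, not_false_iff, true_imp_iff]
      exact isOpen_lt (by fun_prop) continuous_const
  · by_cases hi : i ∈ S
    · simp only [hi, true_imp_iff]
      have hc : Continuous fun t : Fin m → I => N * (t i : ℝ) := by fun_prop
      exact (isOpen_lt continuous_const hc).inter (isOpen_lt hc continuous_const)
    · simp [hi]

theorem exists_mem_facePiece {m : ℕ} (N : ℕ) (t : Fin m → I) :
    ∃ S z, t ∈ facePiece N S z := by
  classical
  obtain ⟨S, h1, h2⟩ := exists_finset_gap fun i => |N * (t i : ℝ) - round (N * (t i : ℝ))|
  refine ⟨S, fun i => if i ∈ S then ⌊N * (t i : ℝ)⌋ else round (N * (t i : ℝ)), fun i hi => ?_,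
    fun i hi => ?_⟩
  · simpa [hi] using h1 i hi
  · simp only [hi, if_true]
    have h3 := (h2 i hi).trans_le (round_le _ ⌊N * (t i : ℝ)⌋)
    have h4 := (h2 i hi).trans_le (round_le _ (⌊N * (t i : ℝ)⌋ + 1))
    rw [abs_of_nonneg (sub_nonneg.2 (Int.floor_le _))] at h3
    push_cast at h4
    rw [abs_of_nonpos (by linarith [Int.lt_floor_add_one (N * (t i : ℝ))])] at h4
    constructor <;> linarith

theorem one_div_two_mul_add_three_le (s : ℕ) : 1 / (2 * (s : ℝ) + 3) ≤ 1 / 3 :=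
  one_div_le_one_div_of_le (by norm_num) (by linarith [Nat.cast_nonneg (α := ℝ) s])

/-- Faces of equal dimension use the same threshold, so no coordinate can be both near and far from
the integers. Hence pieces of one dimension are disjoint, and the `m + 1` dimensions bound the order
of the cover. -/
theorem eq_of_mem_facePiece {m N : ℕ} {S S' : Finset (Fin m)} {z z' : Fin m → ℤ} {t : Fin m → I}
    (h : t ∈ facePiece N S z) (h' : t ∈ facePiece N S' z') (hc : S.card = S'.card) :
    S = S' ∧ z = z' := by
  have hθ := one_div_two_mul_add_three_le S.card
  have hθ0 : 0 < 1 / (2 * (S.card : ℝ) + 3) := by positivity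
  have hS : S = S' := by
    refine Finset.eq_of_subset_of_card_le (fun i hi => ?_) hc.ge
    by_contra hi'
    obtain ⟨h1, h2⟩ := h.2 i hi
    have h3 := h'.1 i hi'
    rw [← hc, abs_lt] at h3
    have h4 : (z i : ℝ) < z' i := by linarith
    have h5 : (z' i : ℝ) < z i + 1 := by linarith
    have h4' : z i < z' i := by exact_mod_cast h4
    have h5' : z' i < z i + 1 := by exact_mod_cast h5
    omega
  subst hS
  refine ⟨rfl, funext fun i => ?_⟩
  have key : (z i : ℝ) < z' i + 1 ∧ (z' i : ℝ) < z i + 1 := by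
    by_cases hi : i ∈ S
    · obtain ⟨h1, h2⟩ := h.2 i hi
      obtain ⟨h3, h4⟩ := h'.2 i hi
      constructor <;> linarith
    · have h1 := abs_lt.1 (h.1 i hi)
      have h2 := abs_lt.1 (h'.1 i hi)
      constructor <;> linarith
  have h1 : z i < z' i + 1 := by exact_mod_cast key.1
  have h2 : z' i < z i + 1 := by exact_mod_cast key.2
  omega

theorem dist_le_of_mem_facePiece {m N : ℕ} (hN : 0 < N) {S : Finset (Fin m)} {z : Fin m → ℤ}
    {t t' : Fin m → I} (h : t ∈ facePiece N S z) (h' : t' ∈ facePiece N S z) :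
    dist t t' ≤ 1 / N := by
  have hN' : (0 : ℝ) < N := by exact_mod_cast hN
  have hθ := one_div_two_mul_add_three_le S.card
  have hθ0 : 0 < 1 / (2 * (S.card : ℝ) + 3) := by positivity
  rw [dist_pi_le_iff (by positivity)]
  intro i
  have he : |(t i : ℝ) - t' i| * N = |N * (t i : ℝ) - N * (t' i : ℝ)| := by
    rw [← mul_sub, abs_mul, abs_of_pos hN', mul_comm]
  rw [Subtype.dist_eq, Real.dist_eq, le_div_iff₀ hN', he, abs_le]
  by_cases hi : i ∈ S
  · obtain ⟨h1, h2⟩ := h.2 i hi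
    obtain ⟨h3, h4⟩ := h'.2 i hi
    constructor <;> linarith
  · have h1 := abs_lt.1 (h.1 i hi)
    have h2 := abs_lt.1 (h'.1 i hi)
    constructor <;> linarith

/-- The product of the `m`-cube and a compact metric space with at most one accumulation point
has covering dimension at most `m`. -/
theorem dimLE_cube_prod (m : ℕ) {T : Type u} [MetricSpace T] [CompactSpace T] (τ₀ : T)
    (hT : ∀ τ, τ ≠ τ₀ → IsOpen {τ}) : DimLE m ((Fin m → I) × T) := by
  classical
  intro 𝒰 h𝒰
  obtain ⟨δ, hδ, hleb⟩ := lebesgue_number_lemma_of_metric_sUnion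
    (s := (univ : Set ((Fin m → I) × T))) isCompact_univ h𝒰.1 h𝒰.2.ge
  obtain ⟨N, hN, hNδ⟩ : ∃ N : ℕ, 0 < N ∧ (1 : ℝ) / N < δ := by
    obtain ⟨N, hN⟩ := exists_nat_one_div_lt hδ
    exact ⟨N + 1, Nat.succ_pos _, by simpa using hN⟩
  -- Merging a small ball about `τ₀` partitions `T` into open classes within which distances are
  -- less than `δ`; the factor `T` then adds nothing to the order.
  let c : T → T := fun τ => if dist τ τ₀ < δ / 2 then τ₀ else τ
  have hc : ∀ p, IsOpen (c ⁻¹' {p}) := by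
    have : IsLocallyConstant c := by
      rw [IsLocallyConstant.iff_exists_open]
      intro τ
      by_cases hτ : dist τ τ₀ < δ / 2
      · refine ⟨Metric.ball τ₀ (δ / 2), Metric.isOpen_ball, hτ, fun τ' hτ' => ?_⟩
        rw [Metric.mem_ball] at hτ'
        simp [c, hτ, hτ']
      · refine ⟨{τ}, hT τ ?_, rfl, ?_⟩
        · rintro rfl
          exact hτ (by simpa using hδ)
        · rintro _ rfl
          rfl
    exact fun p => this _
  have hcd : ∀ τ τ', c τ = c τ' → dist τ τ' < δ := by
    intro τ τ' h
    have h2 : dist τ₀ τ₀ < δ / 2 := by simpa using hδ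
    have htri := dist_triangle_right τ τ' τ₀
    by_cases h0 : dist τ τ₀ < δ / 2 <;> by_cases h1 : dist τ' τ₀ < δ / 2 <;>
      simp only [c, h0, h1, if_true, if_false] at h
    · linarith
    · rw [← h] at h1
      exact absurd h2 h1
    · rw [h] at h0
      exact absurd h2 h0
    · simpa [h] using hδ
  let G : Finset (Fin m) → (Fin m → ℤ) → T → Set ((Fin m → I) × T) := fun S z p =>
    facePiece N S z ×ˢ (c ⁻¹' {p})
  refine ⟨{V | V.Nonempty ∧ ∃ S z p, V = G S z p}, ⟨?_, ?_⟩, ?_, ?_⟩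
  · rintro _ ⟨-, S, z, p, rfl⟩
    exact (isOpen_facePiece N S z).prod (hc p)
  · refine eq_univ_of_forall fun b => ?_
    obtain ⟨S, z, h⟩ := exists_mem_facePiece N b.1
    have hb : b ∈ G S z (c b.2) := ⟨h, rfl⟩
    exact ⟨_, ⟨⟨b, hb⟩, S, z, c b.2, rfl⟩, hb⟩
  · rintro _ ⟨⟨b, hb⟩, S, z, p, rfl⟩
    obtain ⟨U, hU, hbU⟩ := hleb b (mem_univ b)
    refine ⟨U, hU, fun b' hb' => hbU ?_⟩
    rw [Metric.mem_ball, Prod.dist_eq, max_lt_iff]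
    exact ⟨(dist_le_of_mem_facePiece hN hb'.1 hb.1).trans_lt hNδ, hcd _ _ (hb'.2.trans hb.2.symm)⟩
  · intro b
    let r : Set ((Fin m → I) × T) → ℕ := fun V =>
      if h : ∃ S z p, V = G S z p then h.choose.card else 0
    have hr : ∀ V, (∃ S z p, V = G S z p) → ∃ S z p, V = G S z p ∧ r V = S.card := by
      intro V h
      obtain ⟨z, p, hV⟩ := h.choose_spec
      exact ⟨h.choose, z, p, hV, by simp only [r, h, dif_pos]⟩
    have hle : ({V ∈ {V : Set ((Fin m → I) × T) | V.Nonempty ∧ ∃ S z p, V = G S z p} |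
        b ∈ V}).encard ≤ ((Finset.range (m + 1) : Finset ℕ) : Set ℕ).encard := by
      refine encard_le_encard_of_injOn (f := r) ?_ ?_
      · rintro V ⟨⟨-, hV⟩, -⟩
        obtain ⟨S, z, p, -, h⟩ := hr V hV
        rw [h]
        simpa [Nat.lt_succ_iff] using Finset.card_le_univ S
      · rintro V ⟨⟨-, hV⟩, hb⟩ V' ⟨⟨-, hV'⟩, hb'⟩ h
        obtain ⟨S, z, p, rfl, h1⟩ := hr V hV
        obtain ⟨S', z', p', rfl, h2⟩ := hr V' hV'
        obtain ⟨rfl, rfl⟩ := eq_of_mem_facePiece hb.1 hb'.1 (by rw [← h1, ← h2, h])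
        have hp : p = p' := hb.2.symm.trans hb'.2
        rw [hp]
    rw [encard_coe_eq_coe_finsetCard, Finset.card_range] at hle
    exact_mod_cast hle

theorem DimLE.mono {m n : ℕ} (h : m ≤ n) {Y : Type u} [TopologicalSpace Y] (hY : DimLE m Y) :
    DimLE n Y := by
  intro 𝒰 h𝒰
  obtain ⟨𝒱, h1, h2, h3⟩ := hY 𝒰 h𝒰
  refine ⟨𝒱, h1, h2, fun y => (h3 y).trans ?_⟩
  gcongr

theorem DimLE.of_homeomorph {n : ℕ} {Y : Type u} {Z : Type v} [TopologicalSpace Y]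
    [TopologicalSpace Z] (e : Y ≃ₜ Z) (hY : DimLE n Y) : DimLE n Z := by
  intro 𝒰 h𝒰
  obtain ⟨𝒱, h1, h2, h3⟩ := hY ((fun U => e ⁻¹' U) '' 𝒰) (by
    constructor
    · rintro _ ⟨U, hU, rfl⟩
      exact (h𝒰.1 U hU).preimage e.continuous
    · refine eq_univ_of_forall fun y => ?_
      obtain ⟨U, hU, hy⟩ : e y ∈ ⋃₀ 𝒰 := h𝒰.2 ▸ mem_univ _
      exact ⟨_, ⟨U, hU, rfl⟩, hy⟩)
  refine ⟨(fun V => e.symm ⁻¹' V) '' 𝒱, ⟨?_, ?_⟩, ?_, fun z => ?_⟩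
  · rintro _ ⟨V, hV, rfl⟩
    exact (h1.1 V hV).preimage e.symm.continuous
  · refine eq_univ_of_forall fun z => ?_
    obtain ⟨V, hV, hz⟩ : e.symm z ∈ ⋃₀ 𝒱 := h1.2 ▸ mem_univ _
    exact ⟨_, ⟨V, hV, rfl⟩, hz⟩
  · rintro _ ⟨V, hV, rfl⟩
    obtain ⟨_, ⟨U, hU, rfl⟩, hVU⟩ := h2 V hV
    refine ⟨U, hU, fun z hz => ?_⟩
    simpa using hVU hz
  · refine le_trans ?_ (h3 (e.symm z))
    refine (encard_le_encard ?_).trans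
      (encard_image_le (fun V => e.symm ⁻¹' V) {V ∈ 𝒱 | e.symm z ∈ V})
    rintro _ ⟨⟨V, hV, rfl⟩, hz⟩
    exact ⟨V, ⟨hV, hz⟩, rfl⟩

/-! ### Local extension properties of absolute neighborhood extensors -/

/-- The convergent sequence `1 / (i + 1)` together with its limit. -/
def convSeq : Set ℝ := insert 0 (range fun i : ℕ => 1 / ((i : ℝ) + 1))

instance : CompactSpace convSeq :=
  isCompact_iff_compactSpace.1 tendsto_one_div_add_atTop_nhds_zero_nat.isCompact_insert_range

theorem convSeq_nonneg (τ : convSeq) : 0 ≤ (τ : ℝ) := by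
  rcases τ.2 with h | ⟨i, h⟩
  · exact h.ge
  · rw [← h]
    positivity

/-- The limit point of `convSeq`. -/
def convSeqLimit : convSeq := ⟨0, Or.inl rfl⟩

theorem isOpen_singleton_convSeq {τ : convSeq} (hτ : τ ≠ convSeqLimit) : IsOpen {τ} := by
  have hpos : 0 < (τ : ℝ) := lt_of_le_of_ne (convSeq_nonneg τ) fun h => hτ (Subtype.ext h.symm)
  have hfin : {s : convSeq | (τ : ℝ) / 2 < s}.Finite := by
    refine Finite.of_finite_image (f := Subtype.val) ?_ Subtype.val_injective.injOn
    obtain ⟨K, hK⟩ := exists_nat_one_div_lt (half_pos hpos)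
    refine ((Finset.range K).finite_toSet.image fun i : ℕ => 1 / ((i : ℝ) + 1)).subset ?_
    rintro _ ⟨s, hs, rfl⟩
    change (τ : ℝ) / 2 < s at hs
    rcases s.2 with h | ⟨i, h⟩
    · linarith
    · refine ⟨i, ?_, h⟩
      simp only [Finset.coe_range, mem_Iio]
      by_contra! hi
      have h1 : 1 / ((i : ℝ) + 1) ≤ 1 / ((K : ℝ) + 1) :=
        one_div_le_one_div_of_le (by positivity) (by exact_mod_cast Nat.succ_le_succ hi)
      change 1 / ((i : ℝ) + 1) = s at h
      linarith
  have hop : IsOpen {s : convSeq | (τ : ℝ) / 2 < s} :=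
    isOpen_lt continuous_const continuous_subtype_val
  have h2 : IsClosed ({s : convSeq | (τ : ℝ) / 2 < s} \ {τ}) := (hfin.subset sdiff_subset).isClosed
  have h3 : ({τ} : Set convSeq) = {s : convSeq | (τ : ℝ) / 2 < s} ∩
      ({s : convSeq | (τ : ℝ) / 2 < s} \ {τ})ᶜ := by
    ext s
    simp only [mem_singleton_iff, mem_inter_iff, mem_compl_iff, mem_sdiff, not_and, not_not]
    constructor
    · rintro rfl
      exact ⟨half_lt_self hpos, fun _ => rfl⟩
    · exact fun h => h.2 h.1
  rw [h3]
  exact hop.inter h2.isOpen_compl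

/-- Otherwise there are boundary maps `φ τ`, with image within `τ` of `y`, that have no filling in
`U`. Placed over the points of a sequence converging to `0`, with the constant `y` on the limit
cube, they form one continuous map on a closed set. Its extension to a neighborhood fills `φ τ` in
`U` for some positive `τ`. -/
theorem IsANE.exists_cubeExtension {n : ℕ} {Y : Type v} [MetricSpace Y] (hY : IsANE n Y) {k : ℕ}
    (hk : k < n) {U : Set Y} (hU : IsOpen U) {y : Y} (hy : y ∈ U) :
    ∃ ε > 0, CubeExtension (k + 1) (Metric.ball y ε) U := by
  classical
  by_contra! hno
  have hno' : ∀ τ : ℝ, ∃ φ : (Fin (k + 1) → I) → Y, 0 < τ →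
      ContinuousOn φ (Cube.boundary (Fin (k + 1))) ∧
      (∀ t ∈ Cube.boundary (Fin (k + 1)), φ t ∈ Metric.ball y τ) ∧
      ∀ φ' : (Fin (k + 1) → I) → Y, Continuous φ' →
        EqOn φ φ' (Cube.boundary (Fin (k + 1))) → ¬ ∀ t, φ' t ∈ U := by
    intro τ
    by_cases hτ : 0 < τ
    · have := hno τ hτ
      unfold CubeExtension at this
      push Not at this
      obtain ⟨φ, h1, h2, h3⟩ := this
      refine ⟨φ, fun _ => ⟨h1, h2, fun φ' h4 h5 h6 => ?_⟩⟩
      obtain ⟨t, ht⟩ := h3 φ' h4 h5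
      exact ht (h6 t)
    · exact ⟨fun _ => y, fun h => absurd h hτ⟩
  choose φ hφ using hno'
  set bd := Cube.boundary (Fin (k + 1))
  let B := (Fin (k + 1) → I) × convSeq
  let A : Set B := {b | b.1 ∈ bd ∨ b.2 = convSeqLimit}
  have hA : IsClosed A := ((isClosed_cubeBoundary (k + 1)).preimage continuous_fst).union
    (isClosed_singleton.preimage continuous_snd)
  let Ψ : B → Y := fun b => if b.2 = convSeqLimit then y else φ b.2 b.1
  have hpos : ∀ τ : convSeq, τ ≠ convSeqLimit → 0 < (τ : ℝ) := fun τ hτ =>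
    lt_of_le_of_ne (convSeq_nonneg τ) fun h => hτ (Subtype.ext h.symm)
  have hdist : ∀ b ∈ A, dist (Ψ b) y ≤ b.2 := by
    intro b hb
    by_cases h0 : b.2 = convSeqLimit
    · simp only [Ψ, h0, if_true, dist_self]
      exact convSeq_nonneg _
    · simp only [Ψ, h0, if_false]
      exact ((hφ b.2 (hpos _ h0)).2.1 b.1 (hb.resolve_right h0)).le
  have hΨ : ContinuousOn Ψ A := by
    intro b hb
    by_cases h0 : b.2 = convSeqLimit
    · have hΨb : Ψ b = y := by simp [Ψ, h0]
      rw [ContinuousWithinAt, hΨb, tendsto_iff_dist_tendsto_zero]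
      have ht : Filter.Tendsto (fun b' : B => (b'.2 : ℝ)) (𝓝[A] b) (𝓝 0) := by
        have : Continuous fun b : B => (b.2 : ℝ) := continuous_subtype_val.comp continuous_snd
        have h1 := (this.tendsto b).mono_left (nhdsWithin_le_nhds (s := A))
        rwa [h0] at h1
      exact squeeze_zero' (Filter.Eventually.of_forall fun _ => dist_nonneg)
        (eventually_nhdsWithin_of_forall hdist) ht
    · have hop : IsOpen {b' : B | b'.2 = b.2} :=
        (isOpen_singleton_convSeq h0).preimage continuous_snd
      rw [← continuousWithinAt_inter (hop.mem_nhds rfl)]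
      have h1 : ContinuousOn (fun b' : B => φ b.2 b'.1) (A ∩ {b' : B | b'.2 = b.2}) := by
        refine (hφ b.2 (hpos _ h0)).1.comp continuous_fst.continuousOn ?_
        rintro b' ⟨hb', he⟩
        have he : b'.2 = b.2 := he
        exact hb'.resolve_right fun h => h0 (he ▸ h)
      refine (h1.congr ?_) b ⟨hb, rfl⟩
      rintro b' ⟨-, he⟩
      have he : b'.2 = b.2 := he
      simp only [Ψ, he, h0, if_false]
  -- `IsANE` tests only metric spaces in the universe of `Y`.
  let B' := ULift.{v} B
  let A' : Set B' := ULift.down ⁻¹' A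
  have hdim : DimLE n B' := ((dimLE_cube_prod (k + 1) convSeqLimit fun τ hτ =>
    isOpen_singleton_convSeq hτ).of_homeomorph Homeomorph.ulift.symm).mono hk
  obtain ⟨O, hO, hAO, φ', hφ'⟩ := hY B' hdim A' (hA.preimage continuous_uliftDown)
    ⟨fun a => Ψ a.1.down, hΨ.comp_continuous
      (continuous_uliftDown.comp continuous_subtype_val) fun a => a.2⟩
  have hφ' : ∀ b (hb : ULift.up b ∈ A'), φ' ⟨ULift.up b, hAO hb⟩ = Ψ b := fun b hb =>
    hφ' ⟨ULift.up b, hb⟩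
  let G : Set B := ULift.up ⁻¹' (Subtype.val '' (φ' ⁻¹' U))
  have hG : IsOpen G := (hO.isOpenMap_subtype_val _ (hU.preimage φ'.continuous)).preimage
    continuous_uliftUp
  have hsub : (univ : Set (Fin (k + 1) → I)) ×ˢ {convSeqLimit} ⊆ G := by
    rintro b ⟨-, hb⟩
    have hbA : ULift.up b ∈ A' := Or.inr hb
    refine ⟨⟨ULift.up b, hAO hbA⟩, ?_, rfl⟩
    have hb : b.2 = convSeqLimit := hb
    change φ' _ ∈ U
    rw [hφ' b hbA]
    simpa [Ψ, hb] using hy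
  -- By compactness of the cube, `G` contains entire slices near the limit slice, including one over
  -- a positive `τ`.
  obtain ⟨u, v, -, hv, hu, h0v, huv⟩ := generalized_tube_lemma isCompact_univ isCompact_singleton
    hG hsub
  obtain ⟨τ, hτv, hτ⟩ : ∃ τ ∈ v, τ ≠ convSeqLimit := by
    obtain ⟨ε, hε, hεv⟩ := Metric.isOpen_iff.1 hv convSeqLimit (h0v rfl)
    obtain ⟨i, hi⟩ := exists_nat_one_div_lt hε
    have hp : 0 < 1 / ((i : ℝ) + 1) := by positivity
    refine ⟨⟨1 / ((i : ℝ) + 1), Or.inr ⟨i, rfl⟩⟩, hεv ?_, fun h => ?_⟩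
    · rw [Metric.mem_ball, Subtype.dist_eq, Real.dist_eq]
      simp only [convSeqLimit, sub_zero]
      rwa [abs_of_pos hp]
    · exact hp.ne' (congrArg Subtype.val h)
  have hmem : ∀ t : Fin (k + 1) → I, ((t, τ) : B) ∈ G := fun t => huv ⟨hu (mem_univ t), hτv⟩
  have hmemO : ∀ t : Fin (k + 1) → I, ULift.up ((t, τ) : B) ∈ O := by
    intro t
    obtain ⟨o, -, ho⟩ := hmem t
    rw [← ho]
    exact o.2
  refine (hφ τ (hpos τ hτ)).2.2 (fun t => φ' ⟨ULift.up (t, τ), hmemO t⟩) ?_ ?_ ?_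
  · refine φ'.continuous.comp (Continuous.subtype_mk ?_ _)
    exact continuous_uliftUp.comp (continuous_id.prodMk continuous_const)
  · intro t ht
    have := hφ' (t, τ) (Or.inl ht)
    simp only [this, Ψ, hτ, if_false]
  · intro t
    obtain ⟨o, ho, he⟩ := hmem t
    have : (⟨ULift.up (t, τ), hmemO t⟩ : O) = o := Subtype.ext he.symm
    rw [this]
    exact ho

theorem IsANE.hasLocalExtensions {n : ℕ} {Y : Type v} [MetricSpace Y] (hY : IsANE n Y) :
    HasLocalExtensions n (ContinuousMap.id Y) := by
  intro 𝒰 h𝒰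
  have hU : ∀ y : Y, ∃ U ∈ 𝒰, y ∈ U := fun y => by
    obtain ⟨U, hU, hy⟩ : y ∈ ⋃₀ 𝒰 := h𝒰.2 ▸ mem_univ y
    exact ⟨U, hU, hy⟩
  choose U hU hyU using hU
  choose ε hε hext using fun (y : Y) (k : Fin n) =>
    hY.exists_cubeExtension k.2 (h𝒰.1 _ (hU y)) (hyU y)
  let W : Y → Set Y := fun y => U y ∩ ⋂ k : Fin n, Metric.ball y (ε y k)
  refine ⟨range W, ⟨?_, ?_⟩, ?_⟩
  · rintro _ ⟨y, rfl⟩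
    exact (h𝒰.1 _ (hU y)).inter (isOpen_iInter_of_finite fun k => Metric.isOpen_ball)
  · refine eq_univ_of_forall fun y => ⟨W y, ⟨y, rfl⟩, hyU y, mem_iInter.2 fun k => ?_⟩
    exact Metric.mem_ball_self (hε y k)
  · rintro _ ⟨y, rfl⟩
    refine ⟨U y, hU y, fun z hz => hz.1, fun k hk => (hext y ⟨k, hk⟩).mono ?_ fun z hz => hz⟩
    exact fun z hz => mem_iInter.1 hz.2 ⟨k, hk⟩

/-! ### The main result -/

theorem IsUVMap.isFineNHomotopyEquiv {n : ℕ} {X : Type u} {Y : Type v} [TopologicalSpace X]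
    [MetricSpace Y] (hdim : DimLE n Y) (hY : IsANE n Y) {f : C(X, Y)} (hf : IsUVMap n f) :
    IsFineNHomotopyEquiv.{u, v, w} n f := by
  intro 𝒰 h𝒰
  obtain ⟨𝒱, h𝒱, hX𝒱⟩ := hf.hasLocalExtensions.exists_polyhedron_homotopy.{u, v, w} h𝒰
  obtain ⟨𝒲, h𝒲, hY𝒲⟩ := hY.hasLocalExtensions.exists_polyhedron_homotopy.{v, v, w} h𝒰
  -- One `g` must serve both homotopies, hence the common refinement of the covers obtained for `f`
  -- and for `id_Y`.
  obtain ⟨g, hg⟩ : ∃ g : C(Y, X), ∀ y, ∃ U ∈ image2 (· ∩ ·) 𝒱 𝒲, f (g y) ∈ U ∧ y ∈ U := by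
    rcases isEmpty_or_nonempty X with hX | hX
    · have : IsEmpty Y := by
        by_contra h
        rw [not_isEmpty_iff] at h
        obtain ⟨y⟩ := h
        obtain ⟨_, x, -⟩ := hf.denseRange.exists_mem_open isOpen_univ ⟨y, mem_univ y⟩
        exact isEmptyElim (α := X) (by assumption)
      exact ⟨⟨fun y => isEmptyElim y, continuous_of_const fun y => isEmptyElim y⟩, fun y => isEmptyElim y⟩
    · exact exists_approximate_rightInverse hdim hf.hasLocalExtensions hf.denseRange
        (h𝒱.inter h𝒲)
  refine ⟨g, fun V K hK Φ => ?_, fun V K hK Φ => ?_⟩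
  · have hid : preimageFamily (ContinuousMap.id Y) 𝒰 = 𝒰 := by
      simp [preimageFamily]
    rw [← hid]
    refine hY𝒲 V K hK _ _ fun p => ?_
    obtain ⟨_, ⟨V, hV, W, hW, rfl⟩, h1, h2⟩ := hg (Φ p)
    exact ⟨W, hW, h1.2, h2.2⟩
  · refine hX𝒱 V K hK _ _ fun p => ?_
    obtain ⟨_, ⟨V, hV, W, hW, rfl⟩, h1, h2⟩ := hg (f (Φ p))
    exact ⟨V, hV, h1.1, h2.1⟩

end FineHomotopy

theorem lemmaL (n : ℕ) {X : Type u} {Y : Type v} [TopologicalSpace X] [MetricSpace Y]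
    (hdim : FineHomotopy.DimLE n Y) (hY : FineHomotopy.IsANE n Y)
    (f : C(X, Y)) (hf : FineHomotopy.IsUVMap n f) :
    FineHomotopy.IsFineNHomotopyEquiv.{u, v, w} n f :=
  FineHomotopy.IsUVMap.isFineNHomotopyEquiv hdim hY hf
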